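/- Let $M_0,M_1\ge 1$ be integers and let $\mathbb{S}=\{0\}\times\{1,\dots,M_0\}\,\cup\,\bigcup_{k\ge1}\{k\}\times\{1,\dots,M_1\}$; the states $(k,j)$ form level $k$. Let $\boldsymbol{P}$ be a stochastic matrix on $\mathbb{S}$ of M/G/1 type, with blocks indexed by levels $$\boldsymbol{P}=\begin{pmatrix}\boldsymbol{B}(0)&\boldsymbol{B}(1)&\boldsymbol{B}(2)&\cdots\\ \boldsymbol{B}(-1)&\boldsymbol{A}(0)&\boldsymbol{A}(1)&\cdots\\ \boldsymbol{O}&\boldsymbol{A}(-1)&\boldsymbol{A}(0)&\cdots\\ \vdots&\vdots&\vdots&\ddots\end{pmatrix}.$$ Write $\boldsymbol{e}$ for column vectors of ones, $\overline{\boldsymbol{A}}(k)=\sum_{\ell>k}\boldsymbol{A}(\ell)$, $\overline{\overline{\boldsymbol{A}}}(k)=\sum_{\ell>k}\overline{\boldsymbol{A}}(\ell)$, and similarly for $\boldsymbol{B}$. Assume: (i) $\boldsymbol{P}$ is irreducible; (ii) $\boldsymbol{A}=\sum_{k\ge-1}\boldsymbol{A}(k)$ is an irreducible stochastic matrix, with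 stationary distribution $\boldsymbol{\varpi}$; (iii) $\overline{\boldsymbol{m}}_B=\sum_{k\ge1}k\boldsymbol{B}(k)\boldsymbol{e}$ is finite; (iv) $\overline{\boldsymbol{m}}_A=\sum_{k\ge-1}k\boldsymbol{A}(k)\boldsymbol{e}$ is finite and $\sigma=\boldsymbol{\varpi}\overline{\boldsymbol{m}}_A<0$. Assume also that there are a distribution function $F$ on $\{0,1,2,\dots\}$ and finite vectors $\boldsymbol{c}_A,\boldsymbol{c}_B\ge\boldsymbol{0}$, not both zero, such that, with $\overline{F}=1-F$, $F$ is long-tailed, i.e. $\overline{F}(k)>0$ for all $k\ge0$ and $\lim_{k\to\infty}\overline{F}(k+n)/\overline{F}(k)=1$ for all $n\ge0$, and $$\lim_{N\to\infty}\frac{\overline{\overline{\boldsymbol{A}}}(N)\boldsymbol{e}}{\overline{F}(N)}=\boldsymbol{c}_A,\qquad \lim_{N\to\infty}\frac{\overline{\overline{\boldsymbol{B}}}(N)\boldsymbol{e}}{\overline{F}(N)}=\boldsymbol{c}_B.$$ Let $\boldsymbol{\pi}=(\boldsymbol{\pi}(k))_{k\ge0}$ be the stationary distribution of $\boldsymbol{P}$.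 For $N\ge1$ let $\boldsymbol{P}^{(N)}$ be obtained from $\boldsymbol{P}$ by replacing $\boldsymbol{A}(N)$, $\boldsymbol{B}(N)$ by $\overline{\boldsymbol{A}}(N-1)$, $\overline{\boldsymbol{B}}(N-1)$ and $\boldsymbol{A}(k)$, $\boldsymbol{B}(k)$ by $\boldsymbol{O}$ for all $k>N$, and let $\boldsymbol{\pi}^{(N)}$ be a stationary distribution of $\boldsymbol{P}^{(N)}$. Put $\overline{\boldsymbol{\pi}}(0)=\sum_{\ell\ge1}\boldsymbol{\pi}(\ell)$ and $\overline{\boldsymbol{m}}_A^+=\sum_{k\ge1}k\boldsymbol{A}(k)\boldsymbol{e}$. Let $D$ be the distribution function of the nonnegative level increment in steady state, $$D(k)=\sum_{(\ell,i)\in\mathbb{S}}\pi(\ell,i)\,\mathbb{P}\bigl(\max(X_1-X_0,0)\le k\mid (X_0,J_0)=(\ell,i)\bigr),\qquad k\ge0,$$ where $\{(X_n,J_n)\}$ is the Markov chain with transition matrix $\boldsymbol{P}$, and let $$D_I(k)=\frac{\sum_{\ell=0}^k(1-D(\ell))}{\sum_{\ell\ge1}\ell\,(D(\ell)-D(\ell-1))},\qquad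 \overline{D}_I=1-D_I,$$ be its integrated-tail (equilibrium) distribution function and the tail of the latter. With $\|\boldsymbol{x}\|=\sum_j|x_j|$, for every $k\ge0$, $$\lim_{N\to\infty}\frac{\boldsymbol{\pi}^{(N)}(k)-\boldsymbol{\pi}(k)}{\overline{D}_I(N)}=\frac{\boldsymbol{\pi}(0)\overline{\boldsymbol{m}}_B+\overline{\boldsymbol{\pi}}(0)\overline{\boldsymbol{m}}_A^+}{-\sigma}\,\boldsymbol{\pi}(k)>\boldsymbol{0},$$ $$\lim_{N\to\infty}\frac{1}{\overline{D}_I(N)}\left\|\frac{\boldsymbol{\pi}^{(N)}(k)-\boldsymbol{\pi}(k)}{\boldsymbol{\pi}(k)\boldsymbol{e}}\right\|=\frac{\boldsymbol{\pi}(0)\overline{\boldsymbol{m}}_B+\overline{\boldsymbol{\pi}}(0)\overline{\boldsymbol{m}}_A^+}{-\sigma}>0.$$ -/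

import Mathlib

open Filter Topology

noncomputable section

namespace MG1

/-- The state space `{0} × {1,…,M₀} ∪ ⋃_{k ≥ 1} {k} × {1,…,M₁}`. The state `inl i` is phase `i` of
level `0`, the state `inr (n, j)` is phase `j` of level `n + 1`. -/
abbrev State (M₀ M₁ : ℕ) : Type := Fin M₀ ⊕ (ℕ × Fin M₁)

/-- The level of a state. -/
def State.level {M₀ M₁ : ℕ} : State M₀ M₁ → ℕ
  | .inl _ => 0
  | .inr (n, _) => n + 1

/-- The sum of `f` over the states of level `k`. -/
def levelSum {M₀ M₁ : ℕ} (f : State M₀ M₁ → ℝ) : ℕ → ℝ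
  | 0 => ∑ i, f (.inl i)
  | n + 1 => ∑ j, f (.inr (n, j))

/-- A (possibly infinite) real matrix is stochastic: nonnegative entries, rows summing to one. -/
structure IsStochastic {S : Type*} (P : Matrix S S ℝ) : Prop where
  nonneg : ∀ s t, 0 ≤ P s t
  row_sum : ∀ s, HasSum (fun t => P s t) 1

/-- `μ` is a stationary distribution (a probability row vector with `μ P = μ`) of `P`. -/
structure IsStationaryDist {S : Type*} (P : Matrix S S ℝ) (μ : S → ℝ) : Prop where
  nonneg : ∀ s, 0 ≤ μ s
  total : HasSum μ 1
  invariant : ∀ t, HasSum (fun s => μ s * P s t) (μ t)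

/-- The block components of an upper block-Hessenberg matrix of M/G/1 type. Only `A k` with
`k ≥ -1` and `B k` with `k ≥ 1` are used; `B₀` is the block `B(0)` and `Bdown` is `B(-1)`, whose
sizes differ from those of `B(k)`, `k ≥ 1`. -/
structure Blocks (M₀ M₁ : ℕ) where
  A : ℤ → Matrix (Fin M₁) (Fin M₁) ℝ
  B : ℤ → Matrix (Fin M₀) (Fin M₁) ℝ
  B₀ : Matrix (Fin M₀) (Fin M₀) ℝ
  Bdown : Matrix (Fin M₁) (Fin M₀) ℝ

namespace Blocks

variable {M₀ M₁ : ℕ} (X : Blocks M₀ M₁)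

/-- The M/G/1-type matrix
`B(0)  B(1)  B(2)  B(3) …`
`B(-1) A(0)  A(1)  A(2) …`
`O     A(-1) A(0)  A(1) …`
`O     O     A(-1) A(0) …`
and so on. -/
def P : Matrix (State M₀ M₁) (State M₀ M₁) ℝ
  | .inl i, .inl j => X.B₀ i j
  | .inl i, .inr (n, j) => X.B ((n : ℤ) + 1) i j
  | .inr (m, i), .inl j => if m = 0 then X.Bdown i j else 0
  | .inr (m, i), .inr (n, j) => if m ≤ n + 1 then X.A ((n : ℤ) - m) i j else 0

/-- `A = ∑_{k ≥ -1} A(k)`. -/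
def Asum : Matrix (Fin M₁) (Fin M₁) ℝ :=
  Matrix.of fun i j => ∑' k : ℕ, X.A ((k : ℤ) - 1) i j

/-- `Ā(k) = ∑_{ℓ ≥ k+1} A(ℓ)`. -/
def Abar (k : ℤ) : Matrix (Fin M₁) (Fin M₁) ℝ :=
  Matrix.of fun i j => ∑' m : ℕ, X.A (k + 1 + m) i j

/-- `B̄(k) = ∑_{ℓ ≥ k+1} B(ℓ)`. -/
def Bbar (k : ℤ) : Matrix (Fin M₀) (Fin M₁) ℝ :=
  Matrix.of fun i j => ∑' m : ℕ, X.B (k + 1 + m) i j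

/-- The second-order tail `∑_{ℓ ≥ k+1} Ā(ℓ)`. -/
def Abarbar (k : ℤ) : Matrix (Fin M₁) (Fin M₁) ℝ :=
  Matrix.of fun i j => ∑' m : ℕ, X.Abar (k + 1 + m) i j

/-- The second-order tail `∑_{ℓ ≥ k+1} B̄(ℓ)`. -/
def Bbarbar (k : ℤ) : Matrix (Fin M₀) (Fin M₁) ℝ :=
  Matrix.of fun i j => ∑' m : ℕ, X.Bbar (k + 1 + m) i j

/-- `m̄_A = ∑_{k ≥ -1} k A(k) e`. -/
def mA (i : Fin M₁) : ℝ := ∑' k : ℕ, ((k : ℝ) - 1) * ∑ j, X.A ((k : ℤ) - 1) i j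

/-- `m̄_A⁺ = ∑_{k ≥ 1} k A(k) e`. -/
def mAplus (i : Fin M₁) : ℝ := ∑' k : ℕ, ((k : ℝ) + 1) * ∑ j, X.A ((k : ℤ) + 1) i j

/-- `m̄_B = ∑_{k ≥ 1} k B(k) e`. -/
def mB (i : Fin M₀) : ℝ := ∑' k : ℕ, ((k : ℝ) + 1) * ∑ j, X.B ((k : ℤ) + 1) i j

/-- The mean drift `σ = ϖ m̄_A`, where `ϖ` is the stationary distribution of `A`. -/
def drift (ϖ : Fin M₁ → ℝ) : ℝ := ∑ i, ϖ i * X.mA i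

/-- The level-increment truncation at `N ≥ 1`: the blocks `A(k)`, `B(k)` are kept for `k ≤ N - 1`,
replaced by `Ā(N-1)`, `B̄(N-1)` for `k = N`, and by zero for `k ≥ N + 1`. -/
def trunc (N : ℕ) : Blocks M₀ M₁ where
  A k := if k < N then X.A k else if k = N then X.Abar ((N : ℤ) - 1) else 0
  B k := if k < N then X.B k else if k = N then X.Bbar ((N : ℤ) - 1) else 0
  B₀ := X.B₀
  Bdown := X.Bdown

/-- The standing assumption on the chain: `P` is stochastic and irreducible, `A` is stochastic and
irreducible, `m̄_B` is finite, and the mean drift `σ` is (well defined and) negative. Here `ϖ` is the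
unique stationary distribution of `A`. -/
structure Stable (ϖ : Fin M₁ → ℝ) : Prop where
  stochastic_P : IsStochastic X.P
  irreducible_P : X.P.IsIrreducible
  stochastic_A : IsStochastic X.Asum
  irreducible_A : X.Asum.IsIrreducible
  summable_mB : ∀ i, Summable fun k : ℕ => ((k : ℝ) + 1) * ∑ j, X.B ((k : ℤ) + 1) i j
  stationary_A : IsStationaryDist X.Asum ϖ
  summable_mA : ∀ i, Summable fun k : ℕ => ((k : ℝ) - 1) * ∑ j, X.A ((k : ℤ) - 1) i j
  drift_neg : X.drift ϖ < 0

end Blocks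

/-- `F` is the distribution function of a probability distribution on `{0, 1, 2, …}`. -/
structure IsDistFun (F : ℕ → ℝ) : Prop where
  nonneg : ∀ k, 0 ≤ F k
  mono : Monotone F
  tendsto_one : Tendsto F atTop (𝓝 1)

/-- `F` is long-tailed: its tail `1 - F` is positive and `(1 - F(k+n)) / (1 - F(k)) → 1` as `k → ∞`
for every `n`. -/
structure IsLongTailed (F : ℕ → ℝ) : Prop where
  tail_pos : ∀ k, 0 < 1 - F k
  ratio : ∀ n : ℕ, Tendsto (fun k => (1 - F (k + n)) / (1 - F k)) atTop (𝓝 1)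

namespace Blocks

variable {M₀ M₁ : ℕ} (X : Blocks M₀ M₁)

/-- There are a long-tailed distribution function `F` on `{0, 1, 2, …}` and vectors
`c_A, c_B ≥ 0`, not both zero, to which the second-order tails of `A` and `B`, applied to the
vector `e` of ones and divided by the tail of `F`, converge. -/
def LongTailedIncrements : Prop :=
  ∃ (F : ℕ → ℝ) (cA : Fin M₁ → ℝ) (cB : Fin M₀ → ℝ),
    IsDistFun F ∧ IsLongTailed F ∧ 0 ≤ cA ∧ 0 ≤ cB ∧ (cA ≠ 0 ∨ cB ≠ 0) ∧
    (∀ i, Tendsto (fun N : ℕ => (∑ j, X.Abarbar N i j) / (1 - F N)) atTop (𝓝 (cA i))) ∧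
    (∀ i, Tendsto (fun N : ℕ => (∑ j, X.Bbarbar N i j) / (1 - F N)) atTop (𝓝 (cB i)))

/-- The distribution function `D` of the nonnegative level increment in steady state,
`D(k) = ∑_s μ(s) ℙ(max(X₁ - X₀, 0) ≤ k ∣ (X₀, J₀) = s)`. The subtraction of levels is the
truncated one, that is, `max(X₁ - X₀, 0)`. -/
def nlsCdf (μ : State M₀ M₁ → ℝ) (k : ℕ) : ℝ :=
  ∑' s, μ s * ∑' t, if t.level - s.level ≤ k then X.P s t else 0

/-- The mean `∑_{ℓ ≥ 1} ℓ (D(ℓ) - D(ℓ-1))` of the distribution `D`. -/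
def nlsMean (μ : State M₀ M₁ → ℝ) : ℝ :=
  ∑' n : ℕ, ((n : ℝ) + 1) * (X.nlsCdf μ (n + 1) - X.nlsCdf μ n)

/-- The integrated-tail (equilibrium) distribution function
`D_I(k) = ∑_{ℓ=0}^k (1 - D(ℓ)) / mean of D`. -/
def nlsEquilibrium (μ : State M₀ M₁ → ℝ) (k : ℕ) : ℝ :=
  (∑ l ∈ Finset.range (k + 1), (1 - X.nlsCdf μ l)) / X.nlsMean μ

/-- The constant `(π(0) m̄_B + π̄(0) m̄_A⁺) / (-σ)`, where `π(0)` is the restriction of `μ` to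
level `0` and `π̄(0) = ∑_{ℓ ≥ 1} π(ℓ)`. -/
def limitConst (ϖ : Fin M₁ → ℝ) (μ : State M₀ M₁ → ℝ) : ℝ :=
  ((∑ i, μ (.inl i) * X.mB i) + ∑ j, (∑' n : ℕ, μ (.inr (n, j))) * X.mAplus j) / (- X.drift ϖ)

end Blocks

end MG1

end

/-!
The proof compares the truncated and the original chain through test functions `f`. A stationary
distribution `ν` of the truncated matrix `Q` satisfies `∑ x, ν x * ((Q - I) f) x = 0` as soon as `f`
has bounded mean absolute increments (`IsStationaryDist.tsum_gen`), so no moment of `ν` is needed;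
and a row of `Q` is the image of the row of `P` under the map that lowers the excessive jumps
(`trunc_P_eq`). Two families of test functions suffice.

* For states `s`, `t`, the expected number of visits to `s` before hitting `t` is a bounded `g` with
  `(P - I) g = (π s / π t) 1_t - 1_s` (`exists_bounded_gen_eq`). As `Q` and `P` differ on a bounded
  function by at most the first-order tails `Ā(N) e`, `B̄(N) e`, the ratio `ν s / π s` does not depend
  on `s`, up to an error of that order (`abs_proportional_le`).
* For the level, corrected by a solution `a` of the Poisson equation of the phase matrix `A`,
  `(P - I) f` equals `σ` outside the levels zero and one (`gen_linear`), whereas `(Q - P) f` is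
  exactly minus the second-order tail `Ā̄(N-1) e` or `B̄̄(N-1) e` (`gen_trunc_linear`). This fixes the
  common ratio: up to first-order tails, `ν s / π s - 1` is the `ν`-mean of the second-order tails
  divided by `-σ` (`abs_relative_error_le`).

First-order tails are differences of consecutive second-order ones, hence negligible with respect to
the long-tailed scale `1 - F` (`exists_scale`). The estimate also shows that `ν` converges to `π`
pointwise, and therefore, by Scheffé's lemma, in the masses of the types of states
(`tendsto_marginal`). Finally `1 - D_I(N)` is the `π`-mean of the second-order tails divided by its
value `π(0) m̄_B + π̄(0) m̄_A⁺` at the origin (`one_sub_nlsEquilibrium`).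
-/

namespace MG1

/-! ### Stationary distributions of countable chains -/

section Chain

variable {S : Type*}

/-- The generator `Q - I` of a stochastic matrix `Q` applied to a function `f`, written as the
expected one-step increment of `f`. For an unbounded `f` it is meaningful at `x` only when
`∑ y, Q x y * |f y - f x|` converges. -/
noncomputable def gen (Q : Matrix S S ℝ) (f : S → ℝ) (x : S) : ℝ :=
  ∑' y, Q x y * (f y - f x)

theorem IsStochastic.summable_mul {Q : Matrix S S ℝ} (hQ : IsStochastic Q) {f : S → ℝ} {K : ℝ}
    (hf : ∀ y, |f y| ≤ K) (x : S) : Summable fun y => Q x y * f y := by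
  refine Summable.of_norm_bounded ((hQ.row_sum x).summable.mul_right K) fun y => ?_
  rw [norm_mul, Real.norm_eq_abs, Real.norm_eq_abs, abs_of_nonneg (hQ.nonneg x y)]
  exact mul_le_mul_of_nonneg_left (hf y) (hQ.nonneg x y)

theorem IsStochastic.gen_eq {Q : Matrix S S ℝ} (hQ : IsStochastic Q) {f : S → ℝ} {x : S}
    (hf : Summable fun y => Q x y * f y) : gen Q f x = ∑' y, Q x y * f y - f x := by
  have h := hf.hasSum.sub ((hQ.row_sum x).mul_right (f x))
  rw [one_mul] at h
  rw [gen, ← h.tsum_eq]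
  exact tsum_congr fun y => mul_sub _ _ _

theorem IsStochastic.abs_gen_le {Q : Matrix S S ℝ} (hQ : IsStochastic Q) {f : S → ℝ} {x : S}
    (hf : Summable fun y => Q x y * |f y - f x|) :
    |gen Q f x| ≤ ∑' y, Q x y * |f y - f x| := by
  have h := norm_tsum_le_tsum_norm (f := fun y => Q x y * (f y - f x)) ?_
  · simpa only [gen, Real.norm_eq_abs, abs_mul, abs_of_nonneg (hQ.nonneg x _)] using h
  · simpa only [Real.norm_eq_abs, abs_mul, abs_of_nonneg (hQ.nonneg x _)] using hf

theorem IsStationaryDist.summable_mul {Q : Matrix S S ℝ} {ν : S → ℝ} (hν : IsStationaryDist Q ν)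
    {f : S → ℝ} {K : ℝ} (hf : ∀ y, |f y| ≤ K) : Summable fun y => ν y * f y := by
  refine Summable.of_norm_bounded (hν.total.summable.mul_right K) fun y => ?_
  rw [norm_mul, Real.norm_eq_abs, Real.norm_eq_abs, abs_of_nonneg (hν.nonneg y)]
  exact mul_le_mul_of_nonneg_left (hf y) (hν.nonneg y)

theorem IsStationaryDist.tsum_gen_of_bounded {Q : Matrix S S ℝ} (hQ : IsStochastic Q) {ν : S → ℝ}
    (hν : IsStationaryDist Q ν) {f : S → ℝ} {K : ℝ} (hf : ∀ y, |f y| ≤ K) :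
    ∑' x, ν x * gen Q f x = 0 := by
  have hpos : Summable fun p : S × S => ν p.1 * Q p.1 p.2 := by
    have h0 : (0 : S × S → ℝ) ≤ fun p => ν p.1 * Q p.1 p.2 := fun p =>
      mul_nonneg (hν.nonneg p.1) (hQ.nonneg p.1 p.2)
    refine (summable_prod_of_nonneg h0).2 ⟨fun x => (hQ.row_sum x).summable.mul_left (ν x), ?_⟩
    simpa only [tsum_mul_left, (hQ.row_sum _).tsum_eq, mul_one] using hν.total.summable
  have hsum : Summable (Function.uncurry fun x y : S => ν x * Q x y * f y) := by
    refine Summable.of_norm_bounded (hpos.mul_right K) fun p => ?_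
    have hp := mul_nonneg (hν.nonneg p.1) (hQ.nonneg p.1 p.2)
    simp only [Function.uncurry]
    rw [norm_mul, Real.norm_eq_abs, Real.norm_eq_abs, abs_of_nonneg hp]
    exact mul_le_mul_of_nonneg_left (hf _) hp
  have hcomm := hsum.tsum_comm
  have h1 : ∀ y, ∑' x, ν x * Q x y * f y = ν y * f y := fun y => by
    rw [tsum_mul_right, (hν.invariant y).tsum_eq]
  have h2 : ∀ x, ∑' y, ν x * Q x y * f y = ν x * gen Q f x + ν x * f x := fun x => by
    rw [hQ.gen_eq (hQ.summable_mul hf x), ← mul_add, sub_add_cancel, ← tsum_mul_left]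
    exact tsum_congr fun y => mul_assoc _ _ _
  simp only [h1, h2] at hcomm
  have hs : Summable fun x => ν x * gen Q f x + ν x * f x := by
    simpa only [Function.uncurry, h2] using hsum.prod
  have hf' := hν.summable_mul hf
  have hg : Summable fun x => ν x * gen Q f x := by simpa using hs.sub hf'
  rw [hg.tsum_add hf'] at hcomm
  linarith

/-- A stationary distribution integrates the drift of `f` to zero, even if `f` itself is not
integrable, provided the mean absolute increments of `f` are uniformly bounded. Clamping `f` to
`[-n, n]` does not increase its increments, so that the bounded case passes to the limit by
dominated convergence. -/
theorem IsStationaryDist.tsum_gen {Q : Matrix S S ℝ} (hQ : IsStochastic Q) {ν : S → ℝ}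
    (hν : IsStationaryDist Q ν) {f : S → ℝ} {C : ℝ}
    (hf : ∀ x, Summable fun y => Q x y * |f y - f x|)
    (hC : ∀ x, ∑' y, Q x y * |f y - f x| ≤ C) :
    ∑' x, ν x * gen Q f x = 0 := by
  set c : ℕ → S → ℝ := fun n x => max (-(n : ℝ)) (min n (f x)) with hc
  have hbd : ∀ n x, |c n x| ≤ n := fun n x => by
    have hn : (0 : ℝ) ≤ n := n.cast_nonneg
    rw [abs_le]
    exact ⟨le_max_left _ _, max_le (by linarith) (min_le_left _ _)⟩
  have hlip : ∀ n x y, |c n y - c n x| ≤ |f y - f x| := fun n x y => by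
    have h1 := abs_max_sub_max_le_abs (min (n : ℝ) (f y)) (min (n : ℝ) (f x)) (-(n : ℝ))
    have h2 := abs_min_sub_min_le_max (n : ℝ) (f y) n (f x)
    rw [sub_self, abs_zero, max_eq_right (abs_nonneg _)] at h2
    rw [max_comm _ (-(n : ℝ)), max_comm _ (-(n : ℝ))] at h1
    exact h1.trans h2
  have hev : ∀ x, ∀ᶠ n : ℕ in atTop, c n x = f x := fun x => by
    obtain ⟨m, hm⟩ := exists_nat_ge |f x|
    filter_upwards [eventually_ge_atTop m] with n hn
    have hmn : (m : ℝ) ≤ n := by exact_mod_cast hn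
    have := abs_le.1 (hm.trans hmn)
    simp only [hc]
    rw [min_eq_right this.2, max_eq_right this.1]
  have hgen : ∀ x, Tendsto (fun n => gen Q (c n) x) atTop (𝓝 (gen Q f x)) := fun x => by
    refine tendsto_tsum_of_dominated_convergence (hf x) (fun y => ?_) (.of_forall fun n y => ?_)
    · refine tendsto_const_nhds.congr' ?_
      filter_upwards [hev x, hev y] with n hx hy
      rw [hx, hy]
    · rw [norm_mul, Real.norm_eq_abs, Real.norm_eq_abs, abs_of_nonneg (hQ.nonneg x y)]
      exact mul_le_mul_of_nonneg_left (hlip n x y) (hQ.nonneg x y)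
  have hgenC : ∀ n x, |gen Q (c n) x| ≤ C := fun n x => by
    have hle : ∀ y, Q x y * |c n y - c n x| ≤ Q x y * |f y - f x| := fun y =>
      mul_le_mul_of_nonneg_left (hlip n x y) (hQ.nonneg x y)
    have hs : Summable fun y => Q x y * |c n y - c n x| :=
      Summable.of_nonneg_of_le (fun y => mul_nonneg (hQ.nonneg x y) (abs_nonneg _)) hle (hf x)
    exact (hQ.abs_gen_le hs).trans ((hs.tsum_le_tsum hle (hf x)).trans (hC x))
  have hlim : Tendsto (fun n => ∑' x, ν x * gen Q (c n) x) atTop (𝓝 (∑' x, ν x * gen Q f x)) := by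
    refine tendsto_tsum_of_dominated_convergence (hν.total.summable.mul_right C)
      (fun x => (hgen x).const_mul _) (.of_forall fun n x => ?_)
    rw [norm_mul, Real.norm_eq_abs, Real.norm_eq_abs, abs_of_nonneg (hν.nonneg x)]
    exact mul_le_mul_of_nonneg_left (hgenC n x) (hν.nonneg x)
  have h0 : ∀ n, ∑' x, ν x * gen Q (c n) x = 0 := fun n => hν.tsum_gen_of_bounded hQ (hbd n)
  simp only [h0] at hlim
  exact (tendsto_nhds_unique hlim tendsto_const_nhds)

/-- Backward induction along the transitions of an irreducible matrix. -/
theorem _root_.Matrix.IsIrreducible.backward_induction {P : Matrix S S ℝ} (hP : P.IsIrreducible)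
    {p : S → Prop} {t : S} (ht : p t) (step : ∀ x y, 0 < P x y → p y → p x) (x : S) : p x := by
  let := P.toQuiver
  obtain ⟨w, -⟩ := hP.connected x t
  revert ht
  induction w with
  | nil => exact id
  | cons w e ih => exact fun h => ih (step _ _ e.down h)

theorem IsStationaryDist.pos {P : Matrix S S ℝ} (hP : P.IsIrreducible) {μ : S → ℝ}
    (hμ : IsStationaryDist P μ) (s : S) : 0 < μ s := by
  by_contra hs
  have hs0 : μ s = 0 := le_antisymm (not_lt.1 hs) (hμ.nonneg s)
  have hall : ∀ x, μ x = 0 := by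
    refine hP.backward_induction hs0 fun x y hxy hy => ?_
    have h := le_hasSum (hμ.invariant y) x fun z _ => mul_nonneg (hμ.nonneg z) (hP.nonneg z y)
    rw [hy] at h
    have h0 := hμ.nonneg x
    nlinarith
  have h := hμ.total.tsum_eq
  simp [hall] at h

end Chain

/-! ### Expected visits before a hitting time -/

section Green

variable {S : Type*} [DecidableEq S]

/-- The expected number of visits to `s` during the first `n` steps of the chain with transition
matrix `P`, killed on hitting `t`, as a function of the initial state. -/
noncomputable def visits (P : Matrix S S ℝ) (s t : S) : ℕ → S → ℝ
  | 0, _ => 0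
  | n + 1, x => if x = t then 0 else (if x = s then 1 else 0) + ∑' y, P x y * visits P s t n y

variable {P : Matrix S S ℝ} {s t : S}

theorem visits_bounds (hP : IsStochastic P) (n : ℕ) (x : S) :
    0 ≤ visits P s t n x ∧ visits P s t n x ≤ n := by
  induction n generalizing x with
  | zero => simp [visits]
  | succ n ih =>
    have habs : ∀ y, |visits P s t n y| ≤ n := fun y => by
      rw [abs_of_nonneg (ih y).1]; exact (ih y).2
    have h0 : 0 ≤ ∑' y, P x y * visits P s t n y :=
      tsum_nonneg fun y => mul_nonneg (hP.nonneg x y) (ih y).1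
    have h1 : ∑' y, P x y * visits P s t n y ≤ n := by
      have := (hP.summable_mul habs x).tsum_le_tsum
        (fun y => mul_le_mul_of_nonneg_left (ih y).2 (hP.nonneg x y))
        ((hP.row_sum x).summable.mul_right _)
      rwa [tsum_mul_right, (hP.row_sum x).tsum_eq, one_mul] at this
    have hn : (0 : ℝ) ≤ n := n.cast_nonneg
    simp only [visits]
    push_cast
    split_ifs <;> constructor <;> linarith

theorem summable_mul_visits (hP : IsStochastic P) (n : ℕ) (x : S) :
    Summable fun y => P x y * visits P s t n y :=
  hP.summable_mul (K := n) (fun y => by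
    rw [abs_of_nonneg (visits_bounds hP n y).1]; exact (visits_bounds hP n y).2) x

theorem visits_le_succ (hP : IsStochastic P) (n : ℕ) (x : S) :
    visits P s t n x ≤ visits P s t (n + 1) x := by
  induction n generalizing x with
  | zero => simpa [visits] using (visits_bounds (s := s) (t := t) hP 1 x).1
  | succ n ih =>
    have h := (summable_mul_visits hP n x).tsum_le_tsum
      (fun y => mul_le_mul_of_nonneg_left (ih y) (hP.nonneg x y)) (summable_mul_visits hP (n + 1) x)
    rw [visits, visits]
    split_ifs <;> linarith

/-- No visit is counted before `s` is reached, so that `s` is the best initial state. -/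
theorem visits_le_self (hP : IsStochastic P) (n : ℕ) (x : S) :
    visits P s t n x ≤ visits P s t n s := by
  induction n generalizing x with
  | zero => simp [visits]
  | succ n ih =>
    by_cases hxs : x = s
    · rw [hxs]
    · have h := (summable_mul_visits hP n x).tsum_le_tsum
        (fun y => mul_le_mul_of_nonneg_left (ih y) (hP.nonneg x y))
        ((hP.row_sum x).summable.mul_right _)
      rw [tsum_mul_right, (hP.row_sum x).tsum_eq, one_mul] at h
      have h0 := (visits_bounds (s := s) (t := t) hP (n + 1) s).1
      have h1 := visits_le_succ (s := s) (t := t) hP n s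
      rw [visits]
      simp only [hxs, if_false]
      split_ifs <;> linarith

/-- From any state, `t` is hit with positive probability within a bounded time; this caps the
number of visits to `s` started at `x = s`. -/
theorem visits_uniformly_bounded (hP : IsStochastic P) (hirr : P.IsIrreducible) :
    ∃ K, ∀ n x, visits P s t n x ≤ K := by
  -- The bound propagates backwards along transitions; `δ ≤ 1` keeps it monotone in the time `n`.
  have key : ∃ δ > 0, δ ≤ 1 ∧ ∃ C, ∀ n, visits P s t n s ≤ C + (1 - δ) * visits P s t n s := by
    refine hirr.backward_induction (t := t)
      (p := fun x => ∃ δ > 0, δ ≤ 1 ∧ ∃ C, ∀ n, visits P s t n x ≤ C + (1 - δ) * visits P s t n s)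
      ⟨1, one_pos, le_rfl, 0, fun n => ?_⟩ ?_ s
    · cases n <;> simp [visits]
    rintro x y hxy ⟨δ, hδ, hδ1, C, hC⟩
    have hxy1 : P x y ≤ 1 := le_hasSum (hP.row_sum x) y fun z _ => hP.nonneg x z
    refine ⟨P x y * δ, mul_pos hxy hδ, mul_le_one₀ hxy1 hδ.le hδ1, 1 + P x y * |C|, fun n => ?_⟩
    have hpC : 0 ≤ P x y * |C| := mul_nonneg hxy.le (abs_nonneg C)
    have hq : 0 ≤ 1 - P x y * δ := sub_nonneg.2 (mul_le_one₀ hxy1 hδ.le hδ1)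
    cases n with
    | zero => simp only [visits]; linarith
    | succ m =>
      have hdiff := ((hP.row_sum x).mul_right (visits P s t m s)).sub
        (summable_mul_visits (s := s) (t := t) hP m x).hasSum
      have hle := le_hasSum hdiff y fun z _ => by
        rw [← mul_sub]
        exact mul_nonneg (hP.nonneg x z) (sub_nonneg.2 (visits_le_self hP m z))
      have hy : P x y * visits P s t m y ≤ P x y * (|C| + (1 - δ) * visits P s t m s) :=
        mul_le_mul_of_nonneg_left ((hC m).trans (by linarith [le_abs_self C])) hxy.le
      have hmono := mul_le_mul_of_nonneg_left (visits_le_succ (s := s) (t := t) hP m s) hq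
      have h0 := mul_nonneg hq (visits_bounds (s := s) (t := t) hP (m + 1) s).1
      have hstep : visits P s t (m + 1) x ≤ max 0 (1 + ∑' z, P x z * visits P s t m z) := by
        rw [visits]
        split_ifs <;> simp
      refine hstep.trans (max_le (by linarith) ?_)
      linarith
  obtain ⟨δ, hδ, -, C, hC⟩ := key
  refine ⟨C / δ, fun n x => (visits_le_self hP n x).trans ?_⟩
  rw [le_div_iff₀ hδ]
  linarith [hC n]

/-- The expected number of visits to `s` before hitting `t` is a bounded function whose drift is
concentrated on the two states; stationarity determines its value at `t`. -/
theorem exists_bounded_gen_eq (hP : IsStochastic P) (hirr : P.IsIrreducible) {μ : S → ℝ}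
    (hμ : IsStationaryDist P μ) (s t : S) :
    ∃ (g : S → ℝ) (K : ℝ), (∀ x, |g x| ≤ K) ∧
      ∀ x, gen P g x = (if x = t then μ s / μ t else 0) - (if x = s then 1 else 0) := by
  have hμt := hμ.pos hirr t
  by_cases hst : s = t
  · subst hst
    refine ⟨0, 0, by simp, fun x => ?_⟩
    simp [gen, div_self hμt.ne']
  obtain ⟨K, hK⟩ := visits_uniformly_bounded (s := s) (t := t) hP hirr
  have hlim : ∀ x, ∃ l, Tendsto (fun n => visits P s t n x) atTop (𝓝 l) := fun x =>
    ⟨_, tendsto_atTop_ciSup (monotone_nat_of_le_succ fun n => visits_le_succ hP n x)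
      ⟨K, by rintro _ ⟨n, rfl⟩; exact hK n x⟩⟩
  choose g hg using hlim
  have hg0 : ∀ x, 0 ≤ g x := fun x => ge_of_tendsto' (hg x) fun n => (visits_bounds hP n x).1
  have hgK : ∀ x, |g x| ≤ K := fun x => by
    rw [abs_of_nonneg (hg0 x)]
    exact le_of_tendsto' (hg x) fun n => hK n x
  have hsum : ∀ x, Tendsto (fun n => ∑' y, P x y * visits P s t n y) atTop
      (𝓝 (∑' y, P x y * g y)) := fun x => by
    refine tendsto_tsum_of_dominated_convergence ((hP.row_sum x).summable.mul_right K)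
      (fun y => (hg y).const_mul _) (.of_forall fun n y => ?_)
    rw [norm_mul, Real.norm_eq_abs, Real.norm_eq_abs, abs_of_nonneg (hP.nonneg x y),
      abs_of_nonneg (visits_bounds hP n y).1]
    exact mul_le_mul_of_nonneg_left (hK n y) (hP.nonneg x y)
  have hoff : ∀ x, x ≠ t → gen P g x = -(if x = s then 1 else 0) := fun x hx => by
    have h1 := (hsum x).const_add (if x = s then 1 else 0)
    have h2 : Tendsto (fun n => visits P s t (n + 1) x) atTop
        (𝓝 ((if x = s then 1 else 0) + ∑' y, P x y * g y)) := by
      simpa only [visits, hx, if_false] using h1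
    have h3 := tendsto_nhds_unique ((hg x).comp (tendsto_add_atTop_nat 1)) h2
    rw [hP.gen_eq (hP.summable_mul hgK x), h3]
    ring
  have hform : ∀ x, gen P g x = (if x = t then gen P g t else 0) - (if x = s then 1 else 0) := by
    intro x
    by_cases hx : x = t
    · subst hx
      simp [Ne.symm hst]
    · simp [hoff x hx, hx]
  have hzero := hμ.tsum_gen_of_bounded hP hgK
  have hval : HasSum (fun x => μ x * gen P g x) (μ t * gen P g t - μ s) := by
    have h := (hasSum_ite_eq t (μ t * gen P g t)).sub (hasSum_ite_eq s (μ s))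
    have heq : (fun x => μ x * gen P g x) = fun x =>
        (if x = t then μ t * gen P g t else 0) - (if x = s then μ s else 0) := by
      ext x
      rw [hform x]
      by_cases h1 : x = t
      · rw [if_pos h1, if_pos h1, if_neg fun h2 => hst (h2.symm.trans h1),
          if_neg fun h2 => hst (h2.symm.trans h1), h1, sub_zero, sub_zero]
      · by_cases h2 : x = s
        · simp only [h2, if_true, if_false, hst]; ring
        · simp [h1, h2]
    rwa [heq]
  rw [hval.tsum_eq] at hzero
  refine ⟨g, K, hgK, fun x => ?_⟩
  rw [hform x, show gen P g t = μ s / μ t from by rw [eq_div_iff hμt.ne']; linarith]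

end Green

/-! ### Tails of summable sequences -/

/-- The tail `∑_{m ≥ k} a m` of a sequence, as a function of `k`. -/
noncomputable def tail (a : ℕ → ℝ) (k : ℕ) : ℝ := ∑' m, a (k + m)

section Tail

variable {a : ℕ → ℝ}

theorem tail_nonneg (ha : ∀ k, 0 ≤ a k) (k : ℕ) : 0 ≤ tail a k := tsum_nonneg fun _ => ha _

theorem tail_eq_add (ha : Summable a) (k : ℕ) : tail a k = a k + tail a (k + 1) := by
  have hs : Summable fun m => a (k + m) := by
    simpa only [add_comm] using (summable_nat_add_iff k).2 ha
  rw [tail, hs.tsum_eq_zero_add, tail]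
  exact congrArg _ (tsum_congr fun m => by rw [add_assoc, add_comm 1 m])

theorem sum_range_add_tail (ha : Summable a) (n : ℕ) :
    ∑ k ∈ Finset.range n, a k + tail a n = tail a 0 := by
  induction n with
  | zero => simp
  | succ n ih => rw [Finset.sum_range_succ, ← ih, tail_eq_add ha n, add_assoc]

theorem tendsto_tail (a : ℕ → ℝ) : Tendsto (tail a) atTop (𝓝 0) :=
  (tendsto_sum_nat_add a).congr fun k => tsum_congr fun m => by rw [add_comm]

theorem summable_of_summable_succ_mul (ha : ∀ k, 0 ≤ a k)
    (hs : Summable fun k : ℕ => ((k : ℝ) + 1) * a k) : Summable a :=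
  hs.of_nonneg_of_le ha fun k => by nlinarith [ha k, k.cast_nonneg (α := ℝ)]

/-- The second-order tail, summed along antidiagonals: if `a k` is the mass at `k + 1`, it is the mean
excess over `l`. -/
theorem hasSum_tail_tail (ha : ∀ k, 0 ≤ a k) (hs : Summable fun k : ℕ => ((k : ℝ) + 1) * a k)
    (l : ℕ) : (Summable fun m => tail a (l + m)) ∧
      HasSum (fun k : ℕ => ((k : ℝ) + 1) * a (l + k)) (tail (tail a) l) := by
  have hshift : Summable fun k : ℕ => ((k : ℝ) + 1) * a (l + k) := by
    refine ((summable_nat_add_iff l).2 hs).of_nonneg_of_le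
      (fun k => mul_nonneg (by positivity) (ha _)) fun k => ?_
    rw [add_comm l k]
    refine mul_le_mul_of_nonneg_right ?_ (ha _)
    push_cast
    linarith [l.cast_nonneg (α := ℝ)]
  have hdiag : ∀ n : ℕ, HasSum
      (fun p : Finset.HasAntidiagonal.antidiagonal n => a (l + p.1.1 + p.1.2))
      (((n : ℝ) + 1) * a (l + n)) := by
    intro n
    have h := hasSum_fintype fun p : Finset.HasAntidiagonal.antidiagonal n => a (l + p.1.1 + p.1.2)
    have hval : ∑ p : Finset.HasAntidiagonal.antidiagonal n, a (l + p.1.1 + p.1.2) =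
        ((n : ℝ) + 1) * a (l + n) := by
      have hc : ∀ p : Finset.HasAntidiagonal.antidiagonal n, a (l + p.1.1 + p.1.2) = a (l + n) :=
        fun p => by
        rw [add_assoc, Finset.HasAntidiagonal.mem_antidiagonal.1 p.2]
      rw [Finset.sum_congr rfl fun p _ => hc p]
      simp
    rwa [hval] at h
  have hsig : Summable fun x : Σ n : ℕ, Finset.HasAntidiagonal.antidiagonal n =>
      a (l + x.2.1.1 + x.2.1.2) := by
    rw [summable_sigma_of_nonneg fun x => ha _]
    refine ⟨fun n => (hdiag n).summable, ?_⟩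
    simpa only [(hdiag _).tsum_eq] using hshift
  have hprod : Summable fun p : ℕ × ℕ => a (l + p.1 + p.2) := by
    rw [← Finset.HasAntidiagonal.sigmaAntidiagonalEquivProd.summable_iff]
    exact hsig
  have hfib : ∀ m, HasSum (fun r => a (l + m + r)) (tail a (l + m)) := fun m =>
    (hprod.prod_factor m).hasSum
  have htot := hprod.hasSum.prod_fiberwise hfib
  refine ⟨htot.summable, ?_⟩
  have h1 : HasSum (fun x : Σ n : ℕ, Finset.HasAntidiagonal.antidiagonal n => a (l + x.2.1.1 + x.2.1.2))
      (tail (tail a) l) := by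
    rw [tail, htot.tsum_eq, ← Finset.HasAntidiagonal.sigmaAntidiagonalEquivProd.tsum_eq]
    exact hsig.hasSum
  exact h1.sigma hdiag

theorem summable_tail (ha : ∀ k, 0 ≤ a k) (hs : Summable fun k : ℕ => ((k : ℝ) + 1) * a k) :
    Summable (tail a) := by
  simpa using (hasSum_tail_tail ha hs 0).1

end Tail

/-- A sum over a product with a finite second factor may be evaluated slice by slice. -/
theorem hasSum_prod_fintype {α β : Type*} [Fintype β] {f : α × β → ℝ} {v : β → ℝ}
    (h : ∀ b, HasSum (fun x => f (x, b)) (v b)) : HasSum f (∑ b, v b) := by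
  classical
  have hb : ∀ b, HasSum (fun p : α × β => if p.2 = b then f p else 0) (v b) := fun b => by
    have hinj : Function.Injective fun x : α => (x, b) := fun x y hxy => (Prod.ext_iff.1 hxy).1
    refine (hinj.hasSum_iff ?_).1 (by simpa [Function.comp_def] using h b)
    rintro ⟨x, c⟩ hp
    refine if_neg fun hc => hp ⟨x, ?_⟩
    simp only at hc
    rw [hc]
  have := hasSum_sum (s := Finset.univ) fun b _ => hb b
  simpa using this

variable {M₀ M₁ : ℕ}

/-! ### Upward increments of the level -/

/-- The type of a state: its phase, together with the information whether its level is zero. The law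
of the upward increments of the level depends only on the type. -/
def State.kind : State M₀ M₁ → Fin M₀ ⊕ Fin M₁
  | .inl i => .inl i
  | .inr (_, j) => .inr j

namespace Blocks

variable (X : Blocks M₀ M₁)

/-- The probability of an upward jump by `k + 1` levels into phase `j`. -/
def upBlock : Fin M₀ ⊕ Fin M₁ → ℕ → Fin M₁ → ℝ
  | .inl i, k, j => X.B ((k : ℤ) + 1) i j
  | .inr i, k, j => X.A ((k : ℤ) + 1) i j

/-- The probability of an upward jump by `k + 1` levels. -/
def up (c : Fin M₀ ⊕ Fin M₁) (k : ℕ) : ℝ := ∑ j, X.upBlock c k j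

theorem P_up (x : State M₀ M₁) (k : ℕ) (j : Fin M₁) :
    X.P x (.inr (x.level + k, j)) = X.upBlock x.kind k j := by
  rcases x with i | ⟨m, i⟩
  · simp [P, upBlock, State.kind, State.level]
  · have h : ((m + 1 + k : ℕ) : ℤ) - m = k + 1 := by push_cast; ring
    simp only [P, upBlock, State.kind, State.level, h]
    rw [if_pos (by omega)]

variable {X}

theorem upBlock_nonneg (hP : IsStochastic X.P) (c : Fin M₀ ⊕ Fin M₁) (k : ℕ) (j : Fin M₁) :
    0 ≤ X.upBlock c k j := by
  rcases c with i | i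
  · exact (hP.nonneg (.inl i) (.inr (0 + k, j))).trans_eq (X.P_up (.inl i) k j)
  · exact (hP.nonneg (.inr (0, i)) (.inr (1 + k, j))).trans_eq (X.P_up (.inr (0, i)) k j)

theorem up_nonneg (hP : IsStochastic X.P) (c : Fin M₀ ⊕ Fin M₁) (k : ℕ) : 0 ≤ X.up c k :=
  Finset.sum_nonneg fun j _ => upBlock_nonneg hP c k j

theorem summable_upBlock (hP : IsStochastic X.P) (c : Fin M₀ ⊕ Fin M₁) (j : Fin M₁) :
    Summable fun k => X.upBlock c k j := by
  have key : ∀ x : State M₀ M₁, Summable fun k => X.upBlock x.kind k j := fun x => by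
    have hinj : Function.Injective fun k : ℕ => (Sum.inr (x.level + k, j) : State M₀ M₁) :=
      fun k l h => by simpa using h
    simpa only [Function.comp_def, X.P_up] using (hP.row_sum x).summable.comp_injective hinj
  rcases c with i | i
  · exact key (.inl i)
  · exact key (.inr (0, i))

theorem Abar_sum (hP : IsStochastic X.P) (i : Fin M₁) (N : ℕ) :
    ∑ j, X.Abar N i j = tail (X.up (.inr i)) N := by
  have hs : ∀ j, Summable fun k => X.upBlock (.inr i) (N + k) j := fun j =>
    (summable_upBlock hP (.inr i) j).comp_injective (add_right_injective N)
  simp only [tail, up]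
  rw [Summable.tsum_finsetSum fun j _ => hs j]
  refine Finset.sum_congr rfl fun j _ => tsum_congr fun m => ?_
  simp only [upBlock]
  congr 1
  push_cast
  ring_nf

theorem Bbar_sum (hP : IsStochastic X.P) (i : Fin M₀) (N : ℕ) :
    ∑ j, X.Bbar N i j = tail (X.up (.inl i)) N := by
  have hs : ∀ j, Summable fun k => X.upBlock (.inl i) (N + k) j := fun j =>
    (summable_upBlock hP (.inl i) j).comp_injective (add_right_injective N)
  simp only [tail, up]
  rw [Summable.tsum_finsetSum fun j _ => hs j]
  refine Finset.sum_congr rfl fun j _ => tsum_congr fun m => ?_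
  simp only [upBlock]
  congr 1
  push_cast
  ring_nf

theorem Stable.summable_succ_mul_up {ϖ : Fin M₁ → ℝ} (hX : X.Stable ϖ) (c : Fin M₀ ⊕ Fin M₁) :
    Summable fun k : ℕ => ((k : ℝ) + 1) * X.up c k := by
  rcases c with i | i
  · exact hX.summable_mB i
  · refine ((summable_nat_add_iff 2).2 (hX.summable_mA i)).congr fun k => ?_
    simp only [up, upBlock]
    push_cast
    ring_nf

theorem Stable.summable_succ_mul_upBlock {ϖ : Fin M₁ → ℝ} (hX : X.Stable ϖ)
    (c : Fin M₀ ⊕ Fin M₁) (j : Fin M₁) :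
    Summable fun k : ℕ => ((k : ℝ) + 1) * X.upBlock c k j := by
  refine (hX.summable_succ_mul_up c).of_nonneg_of_le
    (fun k => mul_nonneg (by positivity) (upBlock_nonneg hX.stochastic_P c k j)) fun k => ?_
  exact mul_le_mul_of_nonneg_left (Finset.single_le_sum
    (fun j _ => upBlock_nonneg hX.stochastic_P c k j) (Finset.mem_univ j)) (by positivity)

theorem Stable.Abarbar_sum {ϖ : Fin M₁ → ℝ} (hX : X.Stable ϖ) (i : Fin M₁) (N : ℕ) :
    ∑ j, X.Abarbar N i j = tail (tail (X.up (.inr i))) (N + 1) := by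
  have hP := hX.stochastic_P
  have hent : ∀ k j, X.Abar (k : ℕ) i j = tail (fun k => X.upBlock (.inr i) k j) k := fun k j => by
    refine tsum_congr fun m => ?_
    simp only [upBlock]
    congr 1
    push_cast
    ring_nf
  have hs : ∀ j, Summable fun m : ℕ => X.Abar ((N + 1 + m : ℕ) : ℤ) i j := fun j => by
    simpa only [hent] using (hasSum_tail_tail (fun k => upBlock_nonneg hP (.inr i) k j)
      (hX.summable_succ_mul_upBlock (.inr i) j) (N + 1)).1
  rw [tail, tsum_congr fun m => (Abar_sum hP i (N + 1 + m)).symm,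
    Summable.tsum_finsetSum fun j _ => hs j]
  refine Finset.sum_congr rfl fun j _ => tsum_congr fun m => ?_
  push_cast
  rfl

theorem Stable.Bbarbar_sum {ϖ : Fin M₁ → ℝ} (hX : X.Stable ϖ) (i : Fin M₀) (N : ℕ) :
    ∑ j, X.Bbarbar N i j = tail (tail (X.up (.inl i))) (N + 1) := by
  have hP := hX.stochastic_P
  have hent : ∀ k j, X.Bbar (k : ℕ) i j = tail (fun k => X.upBlock (.inl i) k j) k := fun k j => by
    refine tsum_congr fun m => ?_
    simp only [upBlock]
    congr 1
    push_cast
    ring_nf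
  have hs : ∀ j, Summable fun m : ℕ => X.Bbar ((N + 1 + m : ℕ) : ℤ) i j := fun j => by
    simpa only [hent] using (hasSum_tail_tail (fun k => upBlock_nonneg hP (.inl i) k j)
      (hX.summable_succ_mul_upBlock (.inl i) j) (N + 1)).1
  rw [tail, tsum_congr fun m => (Bbar_sum hP i (N + 1 + m)).symm,
    Summable.tsum_finsetSum fun j _ => hs j]
  refine Finset.sum_congr rfl fun j _ => tsum_congr fun m => ?_
  push_cast
  rfl

/-- The law of the upward increment of the level from `x`. -/
theorem hasSum_increment (hP : IsStochastic X.P) (x : State M₀ M₁) {φ : ℕ → ℝ} (h0 : φ 0 = 0)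
    (hφ : ∀ d, 0 ≤ φ d) {v : ℝ} (hv : HasSum (fun k => φ (k + 1) * X.up x.kind k) v) :
    HasSum (fun y => X.P x y * φ (y.level - x.level)) v := by
  have hs : ∀ j, Summable fun k => φ (k + 1) * X.upBlock x.kind k j := fun j =>
    hv.summable.of_nonneg_of_le
      (fun k => mul_nonneg (hφ _) (upBlock_nonneg hP _ k j)) fun k =>
        mul_le_mul_of_nonneg_left (Finset.single_le_sum
          (fun j _ => upBlock_nonneg hP _ k j) (Finset.mem_univ j)) (hφ _)
  have h1 := hasSum_sum (s := Finset.univ) fun j _ => (hs j).hasSum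
  simp only [← Finset.mul_sum] at h1
  have hv' := h1.unique hv
  have h2 := hasSum_prod_fintype (f := fun p : ℕ × Fin M₁ => φ (p.1 + 1) * X.upBlock x.kind p.1 p.2)
    fun j => (hs j).hasSum
  rw [hv'] at h2
  have hinj : Function.Injective
      fun p : ℕ × Fin M₁ => (Sum.inr (x.level + p.1, p.2) : State M₀ M₁) := by
    rintro ⟨k, i⟩ ⟨l, j⟩ h
    simpa using h
  have hlevel : ∀ y : State M₀ M₁, y ∉ Set.range (fun p : ℕ × Fin M₁ =>
      (Sum.inr (x.level + p.1, p.2) : State M₀ M₁)) → y.level - x.level = 0 := by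
    intro y hy
    rcases y with i | ⟨n, j⟩
    · simp [State.level]
    · by_contra hne
      have hn : x.level + (n - x.level) = n := by
        have : (State.level (.inr (n, j) : State M₀ M₁)) = n + 1 := rfl
        omega
      exact hy ⟨(n - x.level, j), by simp only [hn]⟩
  refine (hinj.hasSum_iff fun y hy => by rw [hlevel y hy, h0, mul_zero]).1 ?_
  convert h2 using 1
  ext ⟨k, j⟩
  have hk : State.level (.inr (x.level + k, j) : State M₀ M₁) - x.level = k + 1 := by
    change x.level + k + 1 - x.level = k + 1
    omega
  simp only [Function.comp_def, hk, X.P_up]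
  exact mul_comm _ _

end Blocks

/-! ### The truncated chain -/

/-- The effect of the truncation at `M + 1` on a transition from `x`: the phase of the target is
kept, and its level is lowered to `x.level + M + 1` if it exceeds that level. -/
def collapse (M : ℕ) (x : State M₀ M₁) : State M₀ M₁ → State M₀ M₁
  | .inl j => .inl j
  | .inr (n, j) => .inr (min n (x.level + M), j)

theorem collapse_fiber_lt {M : ℕ} {x : State M₀ M₁} {n : ℕ} {j : Fin M₁} (h : n < x.level + M) :
    collapse M x ⁻¹' {.inr (n, j)} = {.inr (n, j)} := by
  ext z
  rcases z with i | ⟨m, i⟩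
  · simp [collapse]
  · simp only [collapse, Set.mem_preimage, Set.mem_singleton_iff, Sum.inr.injEq, Prod.mk.injEq]
    exact and_congr_left fun _ => by omega

theorem collapse_fiber_gt {M : ℕ} {x : State M₀ M₁} {n : ℕ} {j : Fin M₁} (h : x.level + M < n) :
    collapse M x ⁻¹' {.inr (n, j)} = ∅ := by
  ext z
  rcases z with i | ⟨m, i⟩
  · simp [collapse]
  · simp only [collapse, Set.mem_preimage, Set.mem_singleton_iff, Sum.inr.injEq, Prod.mk.injEq,
      Set.mem_empty_iff_false, iff_false]
    omega

theorem tsum_collapse_fiber_eq {M : ℕ} {x : State M₀ M₁} {j : Fin M₁} (p : State M₀ M₁ → ℝ) :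
    ∑' z : collapse M x ⁻¹' {.inr (x.level + M, j)}, p z =
      ∑' r : ℕ, p (.inr (x.level + (M + r), j)) := by
  have hinj : Function.Injective fun r : ℕ => (Sum.inr (x.level + (M + r), j) : State M₀ M₁) :=
    fun r s h => by simpa using h
  have hrange : collapse M x ⁻¹' {.inr (x.level + M, j)} =
      Set.range fun r : ℕ => (Sum.inr (x.level + (M + r), j) : State M₀ M₁) := by
    ext z
    rcases z with i | ⟨m, i⟩
    · simp [collapse]
    · simp only [collapse, Set.mem_preimage, Set.mem_singleton_iff, Sum.inr.injEq, Prod.mk.injEq,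
        Set.mem_range]
      constructor
      · rintro ⟨h1, rfl⟩
        exact ⟨m - (x.level + M), by omega, rfl⟩
      · rintro ⟨r, h1, rfl⟩
        exact ⟨by omega, rfl⟩
  rw [hrange]
  exact tsum_range p hinj

namespace Blocks

variable {X : Blocks M₀ M₁}

/-- The rows of the truncated matrix are the images of the rows of `P` under `collapse`. -/
theorem trunc_P_eq (M : ℕ) (x y : State M₀ M₁) :
    (X.trunc (M + 1)).P x y = ∑' z : collapse M x ⁻¹' {y}, X.P x z := by
  rcases y with j | ⟨n, j⟩
  · have hfib : collapse M x ⁻¹' {.inl j} = {.inl j} := by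
      ext z
      rcases z with i | ⟨m, i⟩ <;> simp [collapse]
    rw [hfib, tsum_singleton (.inl j) (X.P x)]
    rcases x with i | ⟨m, i⟩ <;> simp [P, trunc]
  · rcases lt_trichotomy n (x.level + M) with h | h | h
    · rw [collapse_fiber_lt h, tsum_singleton (.inr (n, j)) (X.P x)]
      rcases x with i | ⟨m, i⟩ <;> simp only [P, trunc, State.level] at h ⊢
      · rw [if_pos (by push_cast; omega)]
      · rw [if_pos (c := ((n : ℤ) - m < (M + 1 : ℕ))) (by push_cast; omega)]
    · subst h
      rw [tsum_collapse_fiber_eq (X.P x)]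
      simp only [P_up]
      rcases x with i | ⟨m, i⟩ <;> simp only [trunc, State.kind, upBlock] <;>
        rw [if_neg (by push_cast; omega), if_pos (by push_cast; omega)] <;>
        refine tsum_congr fun r => ?_ <;>
        congr 1 <;>
        push_cast <;>
        ring
    · rw [collapse_fiber_gt h, tsum_empty]
      rcases x with i | ⟨m, i⟩ <;> simp only [P, trunc, State.level] at h ⊢
      · rw [if_neg (by push_cast; omega), if_neg (by push_cast; omega)]
        rfl
      · rw [if_pos (by omega), if_neg (by push_cast; omega), if_neg (by push_cast; omega)]
        rfl

theorem hasSum_trunc {M : ℕ} {x : State M₀ M₁} {h : State M₀ M₁ → ℝ} {v : ℝ}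
    (hv : HasSum (fun z => X.P x z * h (collapse M x z)) v) :
    HasSum (fun y => (X.trunc (M + 1)).P x y * h y) v := by
  have heq : ∀ y, (X.trunc (M + 1)).P x y * h y =
      ∑' z : collapse M x ⁻¹' {y}, X.P x z * h (collapse M x z) := fun y => by
    rw [trunc_P_eq, ← tsum_mul_right]
    refine tsum_congr fun z => ?_
    rw [show collapse M x z = y from z.2]
  simpa only [heq] using hv.tsum_fiberwise (collapse M x)

theorem trunc_stochastic (hP : IsStochastic X.P) (M : ℕ) : IsStochastic (X.trunc (M + 1)).P where
  nonneg x y := by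
    rw [trunc_P_eq]
    exact tsum_nonneg fun z => hP.nonneg x z
  row_sum x := by
    simpa using hasSum_trunc (M := M) (x := x) (h := fun _ => 1) (by simpa using hP.row_sum x)

theorem gen_trunc {M : ℕ} {x : State M₀ M₁} {f : State M₀ M₁ → ℝ}
    (hf : Summable fun z => X.P x z * |f (collapse M x z) - f x|) :
    HasSum (fun z => X.P x z * (f (collapse M x z) - f x)) (gen (X.trunc (M + 1)).P f x) := by
  have hs : Summable fun z => X.P x z * (f (collapse M x z) - f x) := by
    refine Summable.of_norm_bounded hf.norm fun z => ?_
    simp only [norm_mul, Real.norm_eq_abs, abs_abs, le_refl]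
  have h := hasSum_trunc (h := fun y => f y - f x) hs.hasSum
  rw [gen, h.tsum_eq]
  exact hs.hasSum

/-- The probability of an upward jump by more than `N` levels. -/
theorem hasSum_jump_gt (hP : IsStochastic X.P) (x : State M₀ M₁) (N : ℕ) :
    HasSum (fun z => X.P x z * if N < z.level - x.level then 1 else 0)
      (tail (X.up x.kind) N) := by
  have hsu : Summable (X.up x.kind) := summable_sum fun j _ => summable_upBlock hP x.kind j
  refine hasSum_increment hP x (φ := fun d => if N < d then 1 else 0) (by simp)
    (fun d => by split_ifs <;> norm_num) ?_
  have hinj := add_right_injective N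
  refine (hinj.hasSum_iff fun k hk => ?_).1 ?_
  · rw [if_neg fun hlt => hk ⟨k - N, by simp only; omega⟩, zero_mul]
  · have heq : ∀ r, (if N < N + r + 1 then 1 else 0) * X.up x.kind (N + r) =
        X.up x.kind (N + r) := fun r => by rw [if_pos (by omega), one_mul]
    simpa only [Function.comp_def, heq, tail] using (hsu.comp_injective hinj).hasSum

/-- Truncation changes the drift of a bounded function by at most the probability of an upward
jump that is affected by it. -/
theorem abs_gen_trunc_sub_le (hP : IsStochastic X.P) {M : ℕ} {g : State M₀ M₁ → ℝ}
    {K : ℝ} (hg : ∀ x, |g x| ≤ K) (x : State M₀ M₁) :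
    |gen (X.trunc (M + 1)).P g x - gen X.P g x| ≤ 2 * K * tail (X.up x.kind) (M + 1) := by
  have hK : 0 ≤ K := (abs_nonneg _).trans (hg x)
  have hdiff : ∀ y z, |g y - g z| ≤ 2 * K := fun y z => by
    linarith [abs_sub (g y) (g z), hg y, hg z]
  have h1 := gen_trunc (M := M) (x := x) (f := g) <|
    hP.summable_mul (f := fun z => |g (collapse M x z) - g x|) (K := 2 * K)
      (fun y => by rw [abs_abs]; exact hdiff _ _) x
  have h2 := (hP.summable_mul (f := fun z => g z - g x) (fun y => hdiff y x) x).hasSum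
  have h3 := h1.sub h2
  have h4 := (hasSum_jump_gt hP x (M + 1)).mul_left (2 * K)
  have hle : ∀ z, |X.P x z * (g (collapse M x z) - g x) - X.P x z * (g z - g x)| ≤
      2 * K * (X.P x z * if M + 1 < z.level - x.level then 1 else 0) := fun z => by
    rw [← mul_sub, sub_sub_sub_cancel_right, abs_mul, abs_of_nonneg (hP.nonneg x z)]
    by_cases hz : M + 1 < z.level - x.level
    · rw [if_pos hz, mul_one, mul_comm (2 * K)]
      exact mul_le_mul_of_nonneg_left (hdiff _ _) (hP.nonneg x z)
    · have hcz : collapse M x z = z := by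
        rcases z with j | ⟨n, j⟩
        · rfl
        · have : (State.level (.inr (n, j) : State M₀ M₁)) = n + 1 := rfl
          simp only [collapse]
          rw [min_eq_left (by omega)]
      simp [hcz, hz]
  change |gen (X.trunc (M + 1)).P g x - ∑' y, X.P x y * (g y - g x)| ≤ _
  rw [← h3.tsum_eq, ← h4.tsum_eq, ← Real.norm_eq_abs]
  exact tsum_of_norm_bounded h4.summable.hasSum hle

/-! ### The linear test function -/

/-- The level, corrected by `a` according to the phase in levels above zero. -/
def linear (a : Fin M₁ → ℝ) : State M₀ M₁ → ℝ
  | .inl _ => 0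
  | .inr (n, j) => (n : ℝ) + 1 + a j

theorem abs_linear_sub_level_le {a : Fin M₁ → ℝ} {K : ℝ} (hK : 0 ≤ K) (ha : ∀ j, |a j| ≤ K)
    (x : State M₀ M₁) : |linear a x - x.level| ≤ K := by
  rcases x with i | ⟨n, j⟩
  · simpa [linear, State.level] using hK
  · simpa [linear, State.level] using ha j

/-- The chain moves down by at most one level. -/
theorem P_eq_zero_of_level_lt {x z : State M₀ M₁} (h : z.level + 1 < x.level) : X.P x z = 0 := by
  rcases x with i | ⟨m, i⟩ <;> rcases z with j | ⟨n, j⟩ <;> simp only [State.level] at h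
  · omega
  · omega
  · simp only [P]; rw [if_neg (by omega)]
  · simp only [P]; rw [if_neg (by omega)]

theorem Stable.hasSum_mean_increment {ϖ : Fin M₁ → ℝ} (hX : X.Stable ϖ) (x : State M₀ M₁) :
    HasSum (fun z => X.P x z * ((z.level - x.level : ℕ) : ℝ)) (tail (tail (X.up x.kind)) 0) := by
  have hP := hX.stochastic_P
  refine hasSum_increment hP x (φ := fun d => (d : ℝ)) (by simp) (fun d => d.cast_nonneg) ?_
  simpa using (hasSum_tail_tail (up_nonneg hP x.kind) (hX.summable_succ_mul_up x.kind) 0).2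

/-- The mean absolute increments of the linear test function are bounded, whether or not the target
`z` is lowered to a state `θ z` that is not further down than the lower of `z` and `x`. -/
theorem Stable.linear_increments {ϖ : Fin M₁ → ℝ} (hX : X.Stable ϖ) {a : Fin M₁ → ℝ} {K : ℝ}
    (hK : 0 ≤ K) (ha : ∀ j, |a j| ≤ K) (x : State M₀ M₁) {θ : State M₀ M₁ → State M₀ M₁}
    (hθ : ∀ z, (θ z).level ≤ z.level ∧ min z.level x.level ≤ (θ z).level) :
    Summable (fun z => X.P x z * |linear a (θ z) - linear a x|) ∧
      ∑' z, X.P x z * |linear a (θ z) - linear a x| ≤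
        tail (tail (X.up x.kind)) 0 + (1 + 2 * K) := by
  have hP := hX.stochastic_P
  have hb := (hX.hasSum_mean_increment x).add ((hP.row_sum x).mul_right (1 + 2 * K))
  rw [one_mul] at hb
  have hle : ∀ z, X.P x z * |linear a (θ z) - linear a x| ≤
      X.P x z * ((z.level - x.level : ℕ) : ℝ) + X.P x z * (1 + 2 * K) := fun z => by
    by_cases hz : z.level + 1 < x.level
    · simp [P_eq_zero_of_level_lt (X := X) hz]
    rw [← mul_add]
    refine mul_le_mul_of_nonneg_left ?_ (hP.nonneg x z)
    have h1 := abs_le.1 (abs_linear_sub_level_le hK ha (θ z))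
    have h2 := abs_le.1 (abs_linear_sub_level_le hK ha x)
    obtain ⟨h3, h4⟩ := hθ z
    have h5 : ((θ z).level : ℝ) ≤ x.level + (z.level - x.level : ℕ) := by
      exact_mod_cast (by omega : (θ z).level ≤ x.level + (z.level - x.level))
    have h6 : (x.level : ℝ) ≤ (θ z).level + 1 := by
      exact_mod_cast (by omega : x.level ≤ (θ z).level + 1)
    have h7 : (0 : ℝ) ≤ (z.level - x.level : ℕ) := Nat.cast_nonneg _
    rw [abs_le]
    constructor <;> linarith
  have h0 : ∀ z, 0 ≤ X.P x z * |linear a (θ z) - linear a x| := fun z =>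
    mul_nonneg (hP.nonneg x z) (abs_nonneg _)
  have hs := hb.summable.of_nonneg_of_le h0 hle
  exact ⟨hs, hs.tsum_le_of_sum_le fun s => (s.sum_le_sum fun z _ => hle z).trans
    (sum_le_hasSum s (fun z _ => (h0 z).trans (hle z)) hb)⟩

theorem collapse_level (M : ℕ) (x z : State M₀ M₁) :
    (collapse M x z).level ≤ z.level ∧ min z.level x.level ≤ (collapse M x z).level := by
  rcases z with j | ⟨n, j⟩
  · simp [collapse, State.level]
  · change min n (x.level + M) + 1 ≤ n + 1 ∧ min (n + 1) x.level ≤ min n (x.level + M) + 1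
    omega

/-- Truncation lowers the drift of the linear test function by the mean excess of the upward
increment over the truncation level. -/
theorem Stable.gen_trunc_linear {ϖ : Fin M₁ → ℝ} (hX : X.Stable ϖ) (a : Fin M₁ → ℝ) (M : ℕ)
    (x : State M₀ M₁) :
    gen (X.trunc (M + 1)).P (linear a) x =
      gen X.P (linear a) x - tail (tail (X.up x.kind)) (M + 1) := by
  have hP := hX.stochastic_P
  obtain ⟨K, hK, ha⟩ : ∃ K, 0 ≤ K ∧ ∀ j, |a j| ≤ K :=
    ⟨∑ j, |a j|, Finset.sum_nonneg fun j _ => abs_nonneg _, fun j =>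
      Finset.single_le_sum (f := fun j => |a j|) (fun j _ => abs_nonneg _) (Finset.mem_univ j)⟩
  have h1 := gen_trunc (hX.linear_increments hK ha x (collapse_level M x)).1
  have h2 : HasSum (fun z => X.P x z * (linear a z - linear a x)) (gen X.P (linear a) x) := by
    have hs := (hX.linear_increments hK ha x (θ := id) fun z => ⟨le_rfl, min_le_left _ _⟩).1
    refine (Summable.of_norm_bounded hs fun z => ?_).hasSum
    rw [norm_mul, Real.norm_eq_abs, Real.norm_eq_abs, abs_of_nonneg (hP.nonneg x z)]
    rfl
  have hup : HasSum (fun k => ((k + 1 - (M + 1) : ℕ) : ℝ) * X.up x.kind k)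
      (tail (tail (X.up x.kind)) (M + 1)) := by
    have hinj := add_right_injective (M + 1)
    refine (hinj.hasSum_iff fun k hk => ?_).1 ?_
    · have : k + 1 - (M + 1) = 0 := by
        by_contra hne
        exact hk ⟨k - (M + 1), by simp only; omega⟩
      rw [this, Nat.cast_zero, zero_mul]
    · have := (hasSum_tail_tail (up_nonneg hP x.kind) (hX.summable_succ_mul_up x.kind) (M + 1)).2
      simp only [Function.comp_def]
      convert this using 3 with r
      rw [show M + 1 + r + 1 - (M + 1) = r + 1 by omega]
      push_cast
      rfl
  have h3 := hasSum_increment hP x (φ := fun d => ((d - (M + 1) : ℕ) : ℝ)) (by simp)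
    (fun d => Nat.cast_nonneg _) hup
  refine h1.unique ?_
  have heq : ∀ z, X.P x z * (linear a (collapse M x z) - linear a x) =
      X.P x z * (linear a z - linear a x) -
        X.P x z * ((z.level - x.level - (M + 1) : ℕ) : ℝ) := fun z => by
    rw [← mul_sub]
    congr 1
    rcases z with j | ⟨n, j⟩
    · simp [collapse, linear, State.level]
    · have hl : (State.level (.inr (n, j) : State M₀ M₁)) = n + 1 := rfl
      simp only [collapse, linear, hl]
      have hmin : n = min n (x.level + M) + (n + 1 - x.level - (M + 1)) := by omega
      have hcast : (n : ℝ) =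
          (min n (x.level + M) : ℕ) + ((n + 1 - x.level - (M + 1) : ℕ) : ℝ) := by
        exact_mod_cast hmin
      linarith
  simpa only [heq] using h2.sub h3

/-- The Poisson equation `(A - I) a = σ e - m̄_A` of the phase matrix is solvable: as `m̄_A - σ e` has
`ϖ`-mean zero, a combination of expected visit counts is a solution. -/
theorem Stable.exists_phase_correction {ϖ : Fin M₁ → ℝ} (hM₁ : 1 ≤ M₁) (hX : X.Stable ϖ) :
    ∃ a : Fin M₁ → ℝ, ∀ i, ∑ j, X.Asum i j * (a j - a i) = X.drift ϖ - X.mA i := by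
  let t : Fin M₁ := ⟨0, hM₁⟩
  choose g _ _ hg using fun s =>
    exists_bounded_gen_eq hX.stochastic_A hX.irreducible_A hX.stationary_A s t
  have hϖ : ∑ i, ϖ i = 1 := (hasSum_fintype ϖ).unique hX.stationary_A.total
  refine ⟨fun i => ∑ s, (X.mA s - X.drift ϖ) * g s i, fun i => ?_⟩
  have hgen : ∀ s, ∑ j, X.Asum i j * (g s j - g s i) =
      (if i = t then ϖ s / ϖ t else 0) - (if i = s then 1 else 0) := fun s => by
    rw [← hg s i, gen, tsum_fintype]
  calc ∑ j, X.Asum i j * (∑ s, (X.mA s - X.drift ϖ) * g s j - ∑ s, (X.mA s - X.drift ϖ) * g s i)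
      = ∑ s, (X.mA s - X.drift ϖ) * ∑ j, X.Asum i j * (g s j - g s i) := by
        simp only [← Finset.sum_sub_distrib, Finset.mul_sum]
        rw [Finset.sum_comm]
        exact Finset.sum_congr rfl fun s _ => Finset.sum_congr rfl fun j _ => by ring
    _ = (if i = t then (∑ s, (X.mA s - X.drift ϖ) * ϖ s) / ϖ t else 0) -
          (X.mA i - X.drift ϖ) := by
        simp only [hgen]
        simp only [mul_sub, Finset.sum_sub_distrib, mul_ite, mul_one, mul_zero,
          Finset.sum_ite_eq, Finset.mem_univ, if_true]
        congr 1
        split_ifs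
        · rw [Finset.sum_div]
          exact Finset.sum_congr rfl fun s _ => by ring
        · simp
    _ = X.drift ϖ - X.mA i := by
        have h0 : ∑ s, (X.mA s - X.drift ϖ) * ϖ s = 0 := by
          simp only [sub_mul, Finset.sum_sub_distrib, ← Finset.mul_sum, hϖ, mul_one]
          rw [sub_eq_zero, drift]
          exact Finset.sum_congr rfl fun s _ => mul_comm _ _
        simp [h0]

/-- Above level one, the corrected level drifts with constant speed `σ`. -/
theorem Stable.gen_linear {ϖ : Fin M₁ → ℝ} (hX : X.Stable ϖ) {a : Fin M₁ → ℝ}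
    (ha : ∀ i, ∑ j, X.Asum i j * (a j - a i) = X.drift ϖ - X.mA i) (m : ℕ) (i : Fin M₁) :
    gen X.P (linear a) (.inr (m + 1, i)) = X.drift ϖ := by
  have hP := hX.stochastic_P
  have hent : ∀ (k : ℕ) j, X.P (.inr (m + 1, i)) (.inr (m + k, j)) = X.A ((k : ℤ) - 1) i j := by
    intro k j
    simp only [P]
    rw [if_pos (by omega)]
    congr 1
    push_cast
    ring
  have hA0 : ∀ (k : ℕ) j, 0 ≤ X.A ((k : ℤ) - 1) i j := fun k j => by
    rw [← hent]; exact hP.nonneg _ _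
  have hAs : ∀ j, Summable fun k : ℕ => X.A ((k : ℤ) - 1) i j := fun j => by
    have hinj : Function.Injective fun k : ℕ => (Sum.inr (m + k, j) : State M₀ M₁) :=
      fun k l h => by simpa using h
    simpa only [Function.comp_def, hent] using
      (hP.row_sum (.inr (m + 1, i))).summable.comp_injective hinj
  have hAm : ∀ j, Summable fun k : ℕ => ((k : ℝ) - 1) * X.A ((k : ℤ) - 1) i j := fun j => by
    refine Summable.of_norm_bounded (hX.summable_mA i).norm fun k => ?_
    rw [norm_mul, norm_mul]
    refine mul_le_mul_of_nonneg_left ?_ (norm_nonneg _)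
    rw [Real.norm_eq_abs, Real.norm_eq_abs, abs_of_nonneg (hA0 k j),
      abs_of_nonneg (Finset.sum_nonneg fun j _ => hA0 k j)]
    exact Finset.single_le_sum (fun j _ => hA0 k j) (Finset.mem_univ j)
  have hsum : ∀ j, HasSum (fun k : ℕ => X.A ((k : ℤ) - 1) i j * ((k : ℝ) - 1 + (a j - a i)))
      ((∑' k : ℕ, ((k : ℝ) - 1) * X.A ((k : ℤ) - 1) i j) + X.Asum i j * (a j - a i)) := fun j => by
    have hA : HasSum (fun k : ℕ => X.A ((k : ℤ) - 1) i j) (X.Asum i j) := (hAs j).hasSum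
    have h := (hAm j).hasSum.add (hA.mul_right (a j - a i))
    simpa only [mul_add, mul_comm ((_ : ℝ) - 1)] using h
  have htot := hasSum_prod_fintype
    (f := fun p : ℕ × Fin M₁ => X.A ((p.1 : ℤ) - 1) i p.2 * ((p.1 : ℝ) - 1 + (a p.2 - a i))) hsum
  have hmean : ∑ j, ∑' k : ℕ, ((k : ℝ) - 1) * X.A ((k : ℤ) - 1) i j = X.mA i := by
    rw [← Summable.tsum_finsetSum fun j _ => hAm j, mA]
    exact tsum_congr fun k => (Finset.mul_sum _ _ _).symm
  rw [Finset.sum_add_distrib, hmean, ha, add_sub_cancel] at htot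
  have hinj : Function.Injective fun p : ℕ × Fin M₁ => (Sum.inr (m + p.1, p.2) : State M₀ M₁) := by
    rintro ⟨k, i⟩ ⟨l, j⟩ h
    simpa using h
  rw [gen]
  refine ((hinj.hasSum_iff fun z hz => ?_).1 ?_).tsum_eq
  · rcases z with j | ⟨n, j⟩
    · simp [P]
    · have hn : ¬ m + 1 ≤ n + 1 := fun hle => hz ⟨(n - m, j), by
        simp only [Nat.add_sub_cancel' (Nat.le_of_succ_le_succ hle)]⟩
      simp only [P, if_neg hn, zero_mul]
  · have heq : ∀ p : ℕ × Fin M₁, X.P (.inr (m + 1, i)) (.inr (m + p.1, p.2)) *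
        (linear (M₀ := M₀) a (.inr (m + p.1, p.2)) - linear (M₀ := M₀) a (.inr (m + 1, i))) =
        X.A ((p.1 : ℤ) - 1) i p.2 * ((p.1 : ℝ) - 1 + (a p.2 - a i)) := fun p => by
      rw [hent]
      simp only [linear]
      push_cast
      ring
    simpa only [Function.comp_def, heq] using htot

end Blocks

/-! ### Sums over the states of a function of the type -/

/-- The total mass that `μ` gives to the states of a given type. -/
noncomputable def marginal (μ : State M₀ M₁ → ℝ) : Fin M₀ ⊕ Fin M₁ → ℝ
  | .inl i => μ (.inl i)
  | .inr j => ∑' n : ℕ, μ (.inr (n, j))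

theorem hasSum_kind {μ : State M₀ M₁ → ℝ} (hμ : Summable μ) (h : Fin M₀ ⊕ Fin M₁ → ℝ) :
    HasSum (fun s => μ s * h s.kind) (∑ c, marginal μ c * h c) := by
  rw [Fintype.sum_sum_type]
  refine HasSum.sum ?_ ?_
  · exact hasSum_fintype fun i => μ (.inl i) * h (.inl i)
  · refine hasSum_prod_fintype (f := fun p : ℕ × Fin M₁ => μ (.inr p) * h (.inr p.2)) fun j => ?_
    have hinj : Function.Injective fun n : ℕ => (Sum.inr (n, j) : State M₀ M₁) :=
      fun k l h => by simpa using h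
    exact (hμ.comp_injective hinj).hasSum.mul_right _

theorem marginal_nonneg {μ : State M₀ M₁ → ℝ} (hμ : ∀ s, 0 ≤ μ s) (c : Fin M₀ ⊕ Fin M₁) :
    0 ≤ marginal μ c := by
  rcases c with i | j
  · exact hμ _
  · exact tsum_nonneg fun n => hμ _

theorem marginal_pos {μ : State M₀ M₁ → ℝ} (hs : Summable μ) (hμ : ∀ s, 0 < μ s)
    (c : Fin M₀ ⊕ Fin M₁) : 0 < marginal μ c := by
  rcases c with i | j
  · exact hμ _
  · have hinj : Function.Injective fun n : ℕ => (Sum.inr (n, j) : State M₀ M₁) :=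
      fun k l h => by simpa using h
    exact (hs.comp_injective hinj).tsum_pos (fun n => (hμ _).le) 0 (hμ _)

/-- Scheffé's lemma: pointwise convergence of probability vectors carries over to the masses of the
types. -/
theorem tendsto_marginal {μ : State M₀ M₁ → ℝ} {ν : ℕ → State M₀ M₁ → ℝ} (hμ0 : ∀ s, 0 ≤ μ s)
    (hμ : HasSum μ 1) (hν0 : ∀ᶠ N in atTop, ∀ s, 0 ≤ ν N s) (hν : ∀ᶠ N in atTop, HasSum (ν N) 1)
    (hlim : ∀ s, Tendsto (fun N => ν N s) atTop (𝓝 (μ s))) (c : Fin M₀ ⊕ Fin M₁) :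
    Tendsto (fun N => marginal (ν N) c) atTop (𝓝 (marginal μ c)) := by
  have hneg : Tendsto (fun N => ∑' s, max (μ s - ν N s) 0) atTop (𝓝 0) := by
    have h := tendsto_tsum_of_dominated_convergence (𝓕 := atTop) (f := fun N s => max (μ s - ν N s) 0)
      (g := fun _ => (0 : ℝ)) hμ.summable (fun s => ?_) ?_
    · simpa using h
    · simpa using ((tendsto_const_nhds (x := μ s)).sub (hlim s)).max (tendsto_const_nhds (x := (0 : ℝ)))
    · filter_upwards [hν0] with N hN s
      rw [Real.norm_eq_abs, abs_of_nonneg (le_max_right _ _)]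
      exact max_le (by linarith [hN s]) (hμ0 s)
  have hbound : ∀ᶠ N in atTop, |marginal (ν N) c - marginal μ c| ≤
      2 * ∑' s, max (μ s - ν N s) 0 := by
    filter_upwards [hν0, hν] with N h0 h1
    have hs : Summable fun s => max (μ s - ν N s) 0 :=
      hμ.summable.of_nonneg_of_le (fun s => le_max_right _ _)
        fun s => max_le (by linarith [h0 s]) (hμ0 s)
    have habs : HasSum (fun s => |ν N s - μ s|) (2 * ∑' s, max (μ s - ν N s) 0) := by
      have h := (hs.hasSum.mul_left 2).add (h1.sub hμ)
      rw [sub_self, add_zero] at h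
      have heq : ∀ s, 2 * max (μ s - ν N s) 0 + (ν N s - μ s) = |ν N s - μ s| := fun s => by
        rcases le_total (μ s - ν N s) 0 with hle | hle
        · rw [max_eq_right hle, abs_of_nonneg (by linarith)]; ring
        · rw [max_eq_left hle, abs_of_nonpos (by linarith)]; ring
      simpa only [heq] using h
    have hd := (hasSum_kind h1.summable fun b => if b = c then 1 else 0).sub
      (hasSum_kind hμ.summable fun b => if b = c then 1 else 0)
    simp only [mul_ite, mul_one, mul_zero, Finset.sum_ite_eq', Finset.mem_univ, if_true] at hd
    rw [← hd.tsum_eq, ← Real.norm_eq_abs]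
    refine tsum_of_norm_bounded habs fun s => ?_
    split_ifs <;> simp
  refine tendsto_iff_norm_sub_tendsto_zero.2 ?_
  refine squeeze_zero' (.of_forall fun N => norm_nonneg _) hbound ?_
  simpa using hneg.const_mul 2

namespace Blocks

variable {X : Blocks M₀ M₁}

/-! ### The nonnegative level increment in steady state -/

theorem one_sub_nlsCdf (hP : IsStochastic X.P) {μ : State M₀ M₁ → ℝ} (hμ : HasSum μ 1) (k : ℕ) :
    1 - X.nlsCdf μ k = ∑ c, marginal μ c * tail (X.up c) k := by
  have hrow : ∀ s : State M₀ M₁, ∑' t : State M₀ M₁,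
      (if t.level - s.level ≤ k then X.P s t else 0) = 1 - tail (X.up s.kind) k := fun s => by
    rw [← ((hP.row_sum s).sub (hasSum_jump_gt hP s k)).tsum_eq]
    refine tsum_congr fun t => ?_
    by_cases h : t.level - s.level ≤ k
    · rw [if_pos h, if_neg (by omega), mul_zero, sub_zero]
    · rw [if_neg h, if_pos (by omega), mul_one, sub_self]
  have h := hμ.sub (hasSum_kind hμ.summable fun c => tail (X.up c) k)
  rw [nlsCdf, tsum_congr fun s => congrArg (μ s * ·) (hrow s)]
  simp only [mul_sub, mul_one]
  rw [h.tsum_eq, sub_sub_cancel]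

/-- The stationary mean `∑ c, μ c * E[(ξ_c - N)⁺]` of the excess of the upward increment `ξ_c` over
the level `N`. -/
noncomputable def meanExcess (X : Blocks M₀ M₁) (μ : State M₀ M₁ → ℝ) (N : ℕ) : ℝ :=
  ∑ c, marginal μ c * tail (tail (X.up c)) N

theorem Stable.nlsMean_eq {ϖ : Fin M₁ → ℝ} (hX : X.Stable ϖ) {μ : State M₀ M₁ → ℝ}
    (hμ : HasSum μ 1) : X.nlsMean μ = X.meanExcess μ 0 := by
  have hP := hX.stochastic_P
  have hup := fun c => summable_of_summable_succ_mul (up_nonneg hP c) (hX.summable_succ_mul_up c)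
  have hdiff : ∀ n, X.nlsCdf μ (n + 1) - X.nlsCdf μ n = ∑ c, marginal μ c * X.up c n := fun n => by
    have h : X.nlsCdf μ (n + 1) - X.nlsCdf μ n =
      (1 - X.nlsCdf μ n) - (1 - X.nlsCdf μ (n + 1)) := by ring
    rw [h, one_sub_nlsCdf hP hμ, one_sub_nlsCdf hP hμ, ← Finset.sum_sub_distrib]
    refine Finset.sum_congr rfl fun c _ => ?_
    rw [tail_eq_add (hup c) n]
    ring
  have h := hasSum_sum (s := Finset.univ) fun c _ =>
    (hasSum_tail_tail (up_nonneg hP c) (hX.summable_succ_mul_up c) 0).2.mul_left (marginal μ c)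
  rw [nlsMean, meanExcess, ← h.tsum_eq]
  refine tsum_congr fun n => ?_
  rw [hdiff, Finset.mul_sum]
  refine Finset.sum_congr rfl fun c _ => ?_
  rw [zero_add]
  ring

theorem Stable.one_sub_nlsEquilibrium {ϖ : Fin M₁ → ℝ} (hX : X.Stable ϖ) {μ : State M₀ M₁ → ℝ}
    (hμ : HasSum μ 1) (h0 : X.meanExcess μ 0 ≠ 0) (N : ℕ) :
    1 - X.nlsEquilibrium μ N = X.meanExcess μ (N + 1) / X.meanExcess μ 0 := by
  have hP := hX.stochastic_P
  have hsum : ∑ l ∈ Finset.range (N + 1), (1 - X.nlsCdf μ l) + X.meanExcess μ (N + 1) =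
      X.meanExcess μ 0 := by
    simp only [one_sub_nlsCdf hP hμ, meanExcess]
    rw [Finset.sum_comm, ← Finset.sum_add_distrib]
    refine Finset.sum_congr rfl fun c _ => ?_
    rw [← Finset.mul_sum, ← mul_add,
      sum_range_add_tail (summable_tail (up_nonneg hP c) (hX.summable_succ_mul_up c))]
  rw [nlsEquilibrium, hX.nlsMean_eq hμ, eq_div_iff h0, sub_mul, div_mul_cancel₀ _ h0]
  linarith

theorem Stable.limitConst_eq {ϖ : Fin M₁ → ℝ} (hX : X.Stable ϖ) (μ : State M₀ M₁ → ℝ) :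
    X.limitConst ϖ μ = X.meanExcess μ 0 / (-X.drift ϖ) := by
  have hmean : ∀ c, ∑' k : ℕ, ((k : ℝ) + 1) * X.up c k = tail (tail (X.up c)) 0 := fun c => by
    simpa using (hasSum_tail_tail (up_nonneg hX.stochastic_P c)
      (hX.summable_succ_mul_up c) 0).2.tsum_eq
  simp only [limitConst, meanExcess, Fintype.sum_sum_type, ← hmean]
  rfl

/-! ### The perturbation of the stationary distribution -/

theorem marginal_le_one {μ : State M₀ M₁ → ℝ} (h0 : ∀ s, 0 ≤ μ s) (h1 : HasSum μ 1)
    (c : Fin M₀ ⊕ Fin M₁) : marginal μ c ≤ 1 := by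
  have h := (hasSum_kind h1.summable fun _ => 1).unique (by simpa using h1)
  simp only [mul_one] at h
  rw [← h]
  exact Finset.single_le_sum (fun c _ => marginal_nonneg h0 c) (Finset.mem_univ c)

/-- Up to terms of the order of the probability that a jump is truncated, a stationary distribution
of the truncated chain is proportional to the one of the original chain. -/
theorem Stable.abs_proportional_le {ϖ : Fin M₁ → ℝ} (hX : X.Stable ϖ) {π : State M₀ M₁ → ℝ}
    (hπ : IsStationaryDist X.P π) (s t : State M₀ M₁) :
    ∃ C, ∀ (M : ℕ) (ν : State M₀ M₁ → ℝ), IsStationaryDist (X.trunc (M + 1)).P ν →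
      |ν s - ν t * (π s / π t)| ≤ C * ∑ c, tail (X.up c) (M + 1) := by
  classical
  have hP := hX.stochastic_P
  obtain ⟨g, K, hK, hg⟩ := exists_bounded_gen_eq hP hX.irreducible_P hπ s t
  have hK0 : 0 ≤ K := (abs_nonneg _).trans (hK s)
  refine ⟨2 * K, fun M ν hν => ?_⟩
  have hQ := trunc_stochastic hP M
  have h0 := hν.tsum_gen_of_bounded hQ hK
  have hbd : HasSum (fun x => ν x * (2 * K * tail (X.up x.kind) (M + 1)))
      (∑ c, marginal ν c * (2 * K * tail (X.up c) (M + 1))) :=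
    hasSum_kind hν.total.summable fun c => 2 * K * tail (X.up c) (M + 1)
  have hle : ∀ x, ‖ν x * (gen (X.trunc (M + 1)).P g x - gen X.P g x)‖ ≤
      ν x * (2 * K * tail (X.up x.kind) (M + 1)) := fun x => by
    rw [norm_mul, Real.norm_eq_abs, Real.norm_eq_abs, abs_of_nonneg (hν.nonneg x)]
    exact mul_le_mul_of_nonneg_left (abs_gen_trunc_sub_le hP hK x) (hν.nonneg x)
  have hd : HasSum (fun x => ν x * gen X.P g x) (ν t * (π s / π t) - ν s) := by
    have h := (hasSum_ite_eq t (ν t * (π s / π t))).sub (hasSum_ite_eq s (ν s))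
    have heq : ∀ x, ν x * gen X.P g x =
        (if x = t then ν t * (π s / π t) else 0) - (if x = s then ν s else 0) := fun x => by
      rw [hg, mul_sub]
      congr 1
      · split_ifs with hx
        · rw [hx]
        · rw [mul_zero]
      · split_ifs with hx
        · rw [hx, mul_one]
        · rw [mul_zero]
    simpa only [heq] using h
  have hs1 : Summable fun x => ν x * (gen (X.trunc (M + 1)).P g x - gen X.P g x) :=
    Summable.of_norm_bounded hbd.summable hle
  have hs2 : ∑' x, ν x * (gen (X.trunc (M + 1)).P g x - gen X.P g x) =
      ν s - ν t * (π s / π t) := by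
    have h := hs1.hasSum.add hd
    have heq : ∀ x, ν x * (gen (X.trunc (M + 1)).P g x - gen X.P g x) + ν x * gen X.P g x =
        ν x * gen (X.trunc (M + 1)).P g x := fun x => by ring
    simp only [heq] at h
    have := h.tsum_eq
    linarith
  rw [← hs2, ← Real.norm_eq_abs]
  refine (tsum_of_norm_bounded hbd hle).trans ?_
  rw [Finset.mul_sum]
  refine Finset.sum_le_sum fun c _ => ?_
  have hnn : 0 ≤ 2 * K * tail (X.up c) (M + 1) :=
    mul_nonneg (by linarith) (tail_nonneg (up_nonneg hP c) _)
  exact mul_le_of_le_one_left hnn (marginal_le_one hν.nonneg hν.total c)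

/-- The states of levels zero and one. -/
def lowStates (M₀ M₁ : ℕ) : Finset (State M₀ M₁) :=
  Finset.univ.image Sum.inl ∪ Finset.univ.image fun j => Sum.inr (0, j)

/-- The balance of the linear test function in the original and in the truncated chain. -/
theorem Stable.exists_balance {ϖ : Fin M₁ → ℝ} (hM₁ : 1 ≤ M₁) (hX : X.Stable ϖ)
    {π : State M₀ M₁ → ℝ} (hπ : IsStationaryDist X.P π) :
    ∃ φ : State M₀ M₁ → ℝ, X.drift ϖ + ∑ x ∈ lowStates M₀ M₁, π x * φ x = 0 ∧
      ∀ (M : ℕ) (ν : State M₀ M₁ → ℝ), IsStationaryDist (X.trunc (M + 1)).P ν →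
        X.drift ϖ + ∑ x ∈ lowStates M₀ M₁, ν x * φ x - X.meanExcess ν (M + 1) = 0 := by
  have hP := hX.stochastic_P
  obtain ⟨a, ha⟩ := hX.exists_phase_correction hM₁
  obtain ⟨K, hK, haK⟩ : ∃ K, 0 ≤ K ∧ ∀ j, |a j| ≤ K :=
    ⟨∑ j, |a j|, Finset.sum_nonneg fun j _ => abs_nonneg _, fun j =>
      Finset.single_le_sum (f := fun j => |a j|) (fun j _ => abs_nonneg _) (Finset.mem_univ j)⟩
  set φ : State M₀ M₁ → ℝ := fun x => gen X.P (linear a) x - X.drift ϖ with hφ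
  have hlow : ∀ x ∉ lowStates M₀ M₁, φ x = 0 := by
    rintro (i | ⟨_ | m, i⟩) hx
    · simp [lowStates] at hx
    · simp [lowStates] at hx
    · simp only [hφ, hX.gen_linear ha, sub_self]
  have hsum : ∀ ν : State M₀ M₁ → ℝ, HasSum ν 1 → HasSum (fun x => ν x * gen X.P (linear a) x)
      (X.drift ϖ + ∑ x ∈ lowStates M₀ M₁, ν x * φ x) := fun ν hν => by
    have h1 : HasSum (fun x => ν x * φ x) (∑ x ∈ lowStates M₀ M₁, ν x * φ x) :=
      hasSum_sum_of_ne_finset_zero fun x hx => by rw [hlow x hx, mul_zero]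
    have h2 := (hν.mul_right (X.drift ϖ)).add h1
    rw [one_mul] at h2
    have heq : ∀ x, ν x * X.drift ϖ + ν x * φ x = ν x * gen X.P (linear a) x := fun x => by
      simp only [hφ]; ring
    simpa only [heq] using h2
  obtain ⟨C, hC⟩ : ∃ C, ∀ x : State M₀ M₁, tail (tail (X.up x.kind)) 0 + (1 + 2 * K) ≤ C :=
    ⟨∑ c, tail (tail (X.up c)) 0 + (1 + 2 * K), fun x => by
      have := Finset.single_le_sum (f := fun c => tail (tail (X.up c)) 0)
        (fun c _ => tail_nonneg (fun k => tail_nonneg (up_nonneg hP c) k) 0)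
        (Finset.mem_univ x.kind)
      simpa using this⟩
  refine ⟨φ, ?_, fun M ν hν => ?_⟩
  · have hinc := fun x => hX.linear_increments hK haK x (θ := id) fun z => ⟨le_rfl, min_le_left _ _⟩
    rw [← (hsum π hπ.total).tsum_eq]
    exact hπ.tsum_gen hP (fun x => (hinc x).1) fun x => (hinc x).2.trans (hC x)
  · have hinc := fun x => hX.linear_increments hK haK x (collapse_level M x)
    have hpush := fun x => hasSum_trunc (h := fun y => |linear a y - linear a x|) (hinc x).1.hasSum
    have h0 := hν.tsum_gen (trunc_stochastic hP M) (fun x => (hpush x).summable)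
      fun x => (hpush x).tsum_eq.trans_le ((hinc x).2.trans (hC x))
    have h1 := (hsum ν hν.total).sub
      (hasSum_kind hν.total.summable fun c => tail (tail (X.up c)) (M + 1))
    rw [meanExcess, ← h1.tsum_eq, ← h0]
    refine tsum_congr fun x => ?_
    rw [hX.gen_trunc_linear, mul_sub]

/-- The key estimate: to first order, the relative error of a stationary distribution of the
truncated chain is the same in every state, namely the mean excess of the upward increments over the
truncation level divided by `-σ`. -/
theorem Stable.abs_relative_error_le {ϖ : Fin M₁ → ℝ} (hM₁ : 1 ≤ M₁) (hX : X.Stable ϖ)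
    {π : State M₀ M₁ → ℝ} (hπ : IsStationaryDist X.P π) (t : State M₀ M₁) :
    ∃ C, ∀ (M : ℕ) (ν : State M₀ M₁ → ℝ), IsStationaryDist (X.trunc (M + 1)).P ν →
      |(ν t - π t) / π t * -X.drift ϖ - X.meanExcess ν (M + 1)| ≤
        C * ∑ c, tail (X.up c) (M + 1) := by
  obtain ⟨φ, hφπ, hφν⟩ := hX.exists_balance hM₁ hπ
  choose C hC using fun s => hX.abs_proportional_le hπ s t
  have hπt := (hπ.pos hX.irreducible_P t).ne'
  refine ⟨∑ x ∈ lowStates M₀ M₁, C x * |φ x|, fun M ν hν => ?_⟩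
  have hid : (ν t - π t) / π t * -X.drift ϖ - X.meanExcess ν (M + 1) =
      -∑ x ∈ lowStates M₀ M₁, (ν x - ν t * (π x / π t)) * φ x := by
    have h1 : ∑ x ∈ lowStates M₀ M₁, (ν x - ν t * (π x / π t)) * φ x =
        ∑ x ∈ lowStates M₀ M₁, ν x * φ x -
          ν t / π t * ∑ x ∈ lowStates M₀ M₁, π x * φ x := by
      rw [Finset.mul_sum, ← Finset.sum_sub_distrib]
      exact Finset.sum_congr rfl fun x _ => by ring
    have h2 := hφν M ν hν
    have h3 : ∑ x ∈ lowStates M₀ M₁, π x * φ x = -X.drift ϖ := by linarith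
    rw [h1, h3, sub_div, div_self hπt]
    linarith
  rw [hid, abs_neg, Finset.sum_mul]
  refine (Finset.abs_sum_le_sum_abs _ _).trans (Finset.sum_le_sum fun x _ => ?_)
  rw [abs_mul, mul_right_comm]
  exact mul_le_mul_of_nonneg_right (hC x M ν hν) (abs_nonneg _)

/-! ### Long-tailed increments -/

theorem meanExcess_nonneg (hP : IsStochastic X.P) {μ : State M₀ M₁ → ℝ} (hμ : ∀ s, 0 ≤ μ s)
    (N : ℕ) : 0 ≤ X.meanExcess μ N :=
  Finset.sum_nonneg fun c _ => mul_nonneg (marginal_nonneg hμ c)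
    (tail_nonneg (fun k => tail_nonneg (up_nonneg hP c) k) N)

/-- The long-tail hypothesis in terms of the upward increments: their second-order tails are
comparable to a function `w`, and their first-order tails are negligible. -/
theorem Stable.exists_scale {ϖ : Fin M₁ → ℝ} (hX : X.Stable ϖ) (htail : X.LongTailedIncrements) :
    ∃ (w : ℕ → ℝ) (l : Fin M₀ ⊕ Fin M₁ → ℝ), (∀ N, 0 < w N) ∧ 0 ≤ l ∧ l ≠ 0 ∧
      (∀ c, Tendsto (fun N => tail (tail (X.up c)) (N + 1) / w N) atTop (𝓝 (l c))) ∧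
      (∀ c, Tendsto (fun N => tail (tail (X.up c)) N / w N) atTop (𝓝 (l c))) ∧
      (∀ c, Tendsto (fun N => tail (X.up c) N / w N) atTop (𝓝 0)) := by
  obtain ⟨F, cA, cB, -, hF, hA, hB, hne, hcA, hcB⟩ := htail
  have hsucc : ∀ c, Tendsto (fun N => tail (tail (X.up c)) (N + 1) / (1 - F N)) atTop
      (𝓝 (Sum.elim cB cA c)) := by
    rintro (i | i)
    · simpa only [hX.Bbarbar_sum, Sum.elim_inl] using hcB i
    · simpa only [hX.Abarbar_sum, Sum.elim_inr] using hcA i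
  have hsame : ∀ c, Tendsto (fun N => tail (tail (X.up c)) N / (1 - F N)) atTop
      (𝓝 (Sum.elim cB cA c)) := fun c => by
    rw [← tendsto_add_atTop_iff_nat 1]
    have h := (hsucc c).div (hF.ratio 1) one_ne_zero
    rw [div_one] at h
    refine h.congr fun N => ?_
    rw [Pi.div_apply, div_div_div_cancel_right₀ (hF.tail_pos N).ne']
  refine ⟨fun N => 1 - F N, Sum.elim cB cA, hF.tail_pos, ?_, ?_, hsucc, hsame, fun c => ?_⟩
  · rintro (i | i)
    · exact hB i
    · exact hA i
  · intro h0
    rcases hne with h | h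
    · exact h (funext fun i => congrFun h0 (.inr i))
    · exact h (funext fun i => congrFun h0 (.inl i))
  · have h := (hsame c).sub (hsucc c)
    rw [sub_self] at h
    refine h.congr fun N => ?_
    rw [tail_eq_add (summable_tail (up_nonneg hX.stochastic_P c) (hX.summable_succ_mul_up c)) N,
      ← sub_div, add_sub_cancel_right]

theorem Stable.meanExcess_zero_pos {ϖ : Fin M₁ → ℝ} (hX : X.Stable ϖ) {μ : State M₀ M₁ → ℝ}
    (hs : Summable μ) (hμ : ∀ s, 0 < μ s) {w : ℕ → ℝ} {l : Fin M₀ ⊕ Fin M₁ → ℝ} (hl : l ≠ 0)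
    (hw : ∀ c, Tendsto (fun N => tail (tail (X.up c)) N / w N) atTop (𝓝 (l c))) :
    0 < X.meanExcess μ 0 := by
  have hnn : ∀ c N, 0 ≤ tail (tail (X.up c)) N := fun c N =>
    tail_nonneg (fun k => tail_nonneg (up_nonneg hX.stochastic_P c) k) N
  obtain ⟨c, hc⟩ := Function.ne_iff.1 hl
  refine Finset.sum_pos' (fun c _ => mul_nonneg (marginal_pos hs hμ c).le (hnn c 0))
    ⟨c, Finset.mem_univ c, mul_pos (marginal_pos hs hμ c) ((hnn c 0).lt_of_ne' fun h0 => hc ?_)⟩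
  have hzero : ∀ N, tail (tail (X.up c)) N = 0 := fun N => by
    have h := sum_range_add_tail
      (summable_tail (up_nonneg hX.stochastic_P c) (hX.summable_succ_mul_up c)) N
    have h1 : 0 ≤ ∑ k ∈ Finset.range N, tail (X.up c) k :=
      Finset.sum_nonneg fun k _ => tail_nonneg (up_nonneg hX.stochastic_P c) k
    exact le_antisymm (by linarith) (hnn c N)
  have h := hw c
  simp only [hzero, zero_div] at h
  exact tendsto_nhds_unique h tendsto_const_nhds

/-- Convergence of the truncated stationary distributions, at the rate of the mean excess. -/
theorem Stable.tendsto_perturbation {ϖ : Fin M₁ → ℝ} (hM₁ : 1 ≤ M₁) (hX : X.Stable ϖ)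
    {π : State M₀ M₁ → ℝ} (hπ : IsStationaryDist X.P π) {ν : ℕ → State M₀ M₁ → ℝ}
    (hν : ∀ N, 1 ≤ N → IsStationaryDist (X.trunc N).P (ν N)) {w : ℕ → ℝ} (hw : ∀ N, 0 < w N)
    {l : Fin M₀ ⊕ Fin M₁ → ℝ}
    (hl : ∀ c, Tendsto (fun N => tail (tail (X.up c)) N / w N) atTop (𝓝 (l c)))
    (h0 : ∀ c, Tendsto (fun N => tail (X.up c) N / w N) atTop (𝓝 0)) (t : State M₀ M₁) :
    Tendsto (fun N => (ν N t - π t) / w N) atTop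
      (𝓝 ((∑ c, marginal π c * l c) / (-X.drift ϖ) * π t)) := by
  have hP := hX.stochastic_P
  have hσ : -X.drift ϖ ≠ 0 := (neg_pos.2 hX.drift_neg).ne'
  have hπpos := hπ.pos hX.irreducible_P
  have hev : ∀ s, ∃ C, ∀ᶠ N in atTop, |(ν N s - π s) / π s * -X.drift ϖ - X.meanExcess (ν N) N| ≤
      C * ∑ c, tail (X.up c) N := fun s => by
    obtain ⟨C, hC⟩ := hX.abs_relative_error_le hM₁ hπ s
    refine ⟨C, ?_⟩
    filter_upwards [eventually_ge_atTop 1] with N hN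
    obtain ⟨M, rfl⟩ := Nat.exists_eq_add_of_le' hN
    exact hC M (ν (M + 1)) (hν _ hN)
  have hinv : ∀ s x m : ℝ, s ≠ 0 →
      (x / s * -X.drift ϖ - m + m) / (-X.drift ϖ) * s = x := fun s x m hs => by
    rw [sub_add_cancel, mul_div_cancel_right₀ _ hσ, div_mul_cancel₀ _ hs]
  have hsum0 : Tendsto (fun N => ∑ c, tail (X.up c) N) atTop (𝓝 0) := by
    simpa using tendsto_finsetSum Finset.univ fun c _ => tendsto_tail (X.up c)
  -- The mean excess itself vanishes in the limit, which gives pointwise convergence.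
  have hT0 : Tendsto (fun N => X.meanExcess (ν N) N) atTop (𝓝 0) := by
    have hb : Tendsto (fun N => ∑ c, tail (tail (X.up c)) N) atTop (𝓝 0) := by
      simpa using tendsto_finsetSum Finset.univ fun c _ => tendsto_tail (tail (X.up c))
    refine squeeze_zero' ?_ ?_ hb
    · filter_upwards [eventually_ge_atTop 1] with N hN
      exact meanExcess_nonneg hP (hν N hN).nonneg N
    · filter_upwards [eventually_ge_atTop 1] with N hN
      exact Finset.sum_le_sum fun c _ => mul_le_of_le_one_left
        (tail_nonneg (fun k => tail_nonneg (up_nonneg hP c) k) N)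
        (marginal_le_one (hν N hN).nonneg (hν N hN).total c)
  have hpt : ∀ s, Tendsto (fun N => ν N s) atTop (𝓝 (π s)) := fun s => by
    obtain ⟨C, hC⟩ := hev s
    have he : Tendsto (fun N => (ν N s - π s) / π s * -X.drift ϖ - X.meanExcess (ν N) N)
        atTop (𝓝 0) := squeeze_zero_norm' hC (by simpa only [mul_zero] using hsum0.const_mul C)
    have h := ((((he.add hT0).div_const (-X.drift ϖ)).mul_const (π s)).add_const (π s))
    simp only [hinv _ _ _ (hπpos s).ne', add_zero, zero_div, zero_mul, zero_add] at h
    simpa only [sub_add_cancel] using h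
  have hmarg := tendsto_marginal hπ.nonneg hπ.total
    ((eventually_ge_atTop 1).mono fun N hN => (hν N hN).nonneg)
    ((eventually_ge_atTop 1).mono fun N hN => (hν N hN).total) hpt
  have hT : Tendsto (fun N => X.meanExcess (ν N) N / w N) atTop (𝓝 (∑ c, marginal π c * l c)) := by
    refine (tendsto_finsetSum Finset.univ fun c _ => (hmarg c).mul (hl c)).congr fun N => ?_
    rw [meanExcess, Finset.sum_div]
    exact Finset.sum_congr rfl fun c _ => (mul_div_assoc _ _ _).symm
  obtain ⟨C, hC⟩ := hev t
  have hE : Tendsto (fun N => ((ν N t - π t) / π t * -X.drift ϖ - X.meanExcess (ν N) N) / w N)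
      atTop (𝓝 0) := by
    have hb : Tendsto (fun N => C * ∑ c, tail (X.up c) N / w N) atTop (𝓝 0) := by
      simpa using (tendsto_finsetSum Finset.univ fun c _ => h0 c).const_mul C
    refine squeeze_zero_norm' ?_ hb
    filter_upwards [hC] with N hN
    rw [norm_div, Real.norm_eq_abs, Real.norm_eq_abs, abs_of_pos (hw N), ← Finset.sum_div,
      ← mul_div_assoc]
    exact div_le_div_of_nonneg_right hN (hw N).le
  have h := ((hE.add hT).div_const (-X.drift ϖ)).mul_const (π t)
  rw [zero_add] at h
  refine h.congr fun N => ?_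
  rw [← add_div, div_right_comm, div_mul_eq_mul_div, hinv _ _ _ (hπpos t).ne']

end Blocks

theorem levelSum_tendsto {f : ℕ → State M₀ M₁ → ℝ} {g : State M₀ M₁ → ℝ}
    (h : ∀ s, Tendsto (fun N => f N s) atTop (𝓝 (g s))) (k : ℕ) :
    Tendsto (fun N => levelSum (f N) k) atTop (𝓝 (levelSum g k)) := by
  cases k with
  | zero => exact tendsto_finsetSum _ fun i _ => h _
  | succ n => exact tendsto_finsetSum _ fun j _ => h _

theorem levelSum_pos (hM₀ : 1 ≤ M₀) (hM₁ : 1 ≤ M₁) {μ : State M₀ M₁ → ℝ} (hμ : ∀ s, 0 < μ s)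
    (k : ℕ) : 0 < levelSum μ k := by
  cases k with
  | zero => exact Finset.sum_pos (fun i _ => hμ _) ⟨⟨0, hM₀⟩, Finset.mem_univ _⟩
  | succ n => exact Finset.sum_pos (fun i _ => hμ _) ⟨⟨0, hM₁⟩, Finset.mem_univ _⟩

theorem levelSum_mul (a : ℝ) (f : State M₀ M₁ → ℝ) (k : ℕ) :
    levelSum (fun s => a * f s) k = a * levelSum f k := by
  cases k <;> exact (Finset.mul_sum _ _ _).symm

end MG1

theorem corollary5p1 {M₀ M₁ : ℕ} (hM₀ : 1 ≤ M₀) (hM₁ : 1 ≤ M₁)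
    (X : MG1.Blocks M₀ M₁) (ϖ : Fin M₁ → ℝ)
    (hX : X.Stable ϖ) (htail : X.LongTailedIncrements)
    (π : MG1.State M₀ M₁ → ℝ) (hπ : MG1.IsStationaryDist X.P π)
    (πN : ℕ → MG1.State M₀ M₁ → ℝ)
    (hπN : ∀ N, 1 ≤ N → MG1.IsStationaryDist (X.trunc N).P (πN N)) :
    0 < X.limitConst ϖ π ∧
    (∀ s, 0 < X.limitConst ϖ π * π s ∧
      Filter.Tendsto (fun N => (πN N s - π s) / (1 - X.nlsEquilibrium π N))
        Filter.atTop (nhds (X.limitConst ϖ π * π s))) ∧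
    (∀ k : ℕ,
      Filter.Tendsto (fun N => 1 / (1 - X.nlsEquilibrium π N) *
          MG1.levelSum (fun s => |(πN N s - π s) / MG1.levelSum π k|) k)
        Filter.atTop (nhds (X.limitConst ϖ π))) := by
  obtain ⟨w, l, hw, hl0, hl, hsucc, hsame, hsmall⟩ := hX.exists_scale htail
  have hpos := hπ.pos hX.irreducible_P
  have hd := hX.meanExcess_zero_pos hπ.total.summable hpos hl hsame
  have hσ : 0 < -X.drift ϖ := neg_pos.2 hX.drift_neg
  have hconst : 0 < X.limitConst ϖ π := by
    rw [hX.limitConst_eq]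
    exact div_pos hd hσ
  have hL : 0 < ∑ c, MG1.marginal π c * l c := by
    obtain ⟨c, hc⟩ := Function.ne_iff.1 hl
    have hm := MG1.marginal_pos hπ.total.summable hpos
    exact Finset.sum_pos' (fun c _ => mul_nonneg (hm c).le (hl0 c))
      ⟨c, Finset.mem_univ c, mul_pos (hm c) ((hl0 c).lt_of_ne' hc)⟩
  have hD : Tendsto (fun N => (1 - X.nlsEquilibrium π N) / w N) atTop
      (𝓝 ((∑ c, MG1.marginal π c * l c) / X.meanExcess π 0)) := by
    refine ((tendsto_finsetSum Finset.univ fun c _ => (hsucc c).const_mul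
      (MG1.marginal π c)).div_const (X.meanExcess π 0)).congr fun N => ?_
    have hsum : X.meanExcess π (N + 1) / w N =
        ∑ c, MG1.marginal π c * (MG1.tail (MG1.tail (X.up c)) (N + 1) / w N) := by
      rw [MG1.Blocks.meanExcess, Finset.sum_div]
      exact Finset.sum_congr rfl fun c _ => mul_div_assoc _ _ _
    rw [hX.one_sub_nlsEquilibrium hπ.total hd.ne', div_right_comm, hsum]
  have hlim : ∀ s, Tendsto (fun N => (πN N s - π s) / (1 - X.nlsEquilibrium π N)) atTop
      (𝓝 (X.limitConst ϖ π * π s)) := fun s => by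
    have hne := (div_pos hL hd).ne'
    have h := (hX.tendsto_perturbation hM₁ hπ hπN hw hsame hsmall s).div hD hne
    have hval : (∑ c, MG1.marginal π c * l c) / (-X.drift ϖ) * π s /
        ((∑ c, MG1.marginal π c * l c) / X.meanExcess π 0) = X.limitConst ϖ π * π s := by
      rw [hX.limitConst_eq]
      have h1 := hL.ne'
      have h2 := hσ.ne'
      have h3 := hd.ne'
      field_simp
    rw [hval] at h
    refine h.congr fun N => ?_
    rw [Pi.div_apply, div_div_div_cancel_right₀ (hw N).ne']
  refine ⟨hconst, fun s => ⟨mul_pos hconst (hpos s), hlim s⟩, fun k => ?_⟩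
  have hk := MG1.levelSum_pos hM₀ hM₁ hpos k
  have hDpos : ∀ N, 0 ≤ 1 - X.nlsEquilibrium π N := fun N => by
    rw [hX.one_sub_nlsEquilibrium hπ.total hd.ne']
    exact div_nonneg (MG1.Blocks.meanExcess_nonneg hX.stochastic_P hπ.nonneg _) hd.le
  have h := MG1.levelSum_tendsto (fun s => ((hlim s).abs.mul_const (1 / MG1.levelSum π k))) k
  have hval : MG1.levelSum (fun s => |X.limitConst ϖ π * π s| * (1 / MG1.levelSum π k)) k =
      X.limitConst ϖ π := by
    have heq : ∀ s, |X.limitConst ϖ π * π s| * (1 / MG1.levelSum π k) =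
        X.limitConst ϖ π / MG1.levelSum π k * π s := fun s => by
      rw [abs_of_pos (mul_pos hconst (hpos s))]
      ring
    simp only [heq]
    rw [MG1.levelSum_mul, div_mul_cancel₀ _ hk.ne']
  rw [hval] at h
  refine h.congr fun N => ?_
  rw [← MG1.levelSum_mul]
  congr 1
  ext s
  rw [abs_div, abs_div, abs_of_nonneg (hDpos N), abs_of_pos hk]
  ring
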